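/- **Setting.** Let $T=(V,E,w)$ be a finite tree of order $n=|V|\ge 2$ with edge weights $w:E\to\mathbb{R}^+$, rooted at a vertex $r$ (the homebase), and let $q\ge 0$ be the invoking cost. For $v\in V$ let $c(v)$ be the list of children of $v$ (in an arbitrary order); a leaf is a vertex without children; $d$ is the weighted distance in $T$. A *strategy* is a finite sequence of moves, starting with no agent in the tree, where each move either invokes a new agent at $r$ or lets one already invoked agent traverse an edge from the vertex that it occupies. A strategy *explores* $T$ if every vertex is visited by at least one agent; agents need not return to $r$. If it uses $k$ agents and the $i$-th agent traverses total distance $d_i$, its cost is $kq+\sum_{i=1}^k d_i$. A strategy that explores $T$ is *cost-optimal* if no strategy that explores $T$ has a smaller cost. **Procedure CostExpl.** It runs SetLabeling at $r$ and then SetStrategy at $r$. *SetLabeling* at $v$ computes a label $\Lambda_v=(k,u_l,u_c)$. If $v$ is a leaf, then $\Lambda_v=(1,v,\mathrm{null})$. Otherwise it first calls itself at every child of $v$, then starts with $k=0$, $d^{\max}=0$ and, for every $u\in c(v)$ in turn, adds $\Lambda_u.k$ to $k$; subtracts $1$ from $k$ if $\Lambda_u.k=1$ and $d(v,\Lambda_u.u_l)\le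 d(r,v)+q$; and, if $d(v,\Lambda_u.u_l)>d^{\max}$, sets $d^{\max}=d(v,\Lambda_u.u_l)$ and $u_c=u$. Finally $\Lambda_v=(\max\{1,k\},\Lambda_{u_c}.u_l,u_c)$. *SetStrategy* at $v$ does nothing if $v$ is a leaf. Otherwise, if $v=r$, it adds the instruction "invoke $\Lambda_r.k$ agents at $r$". Then for every child $u$ of $v$, with $\Lambda_v.u_c$ as the last one, it adds "traverse $(v,u)$ by $\Lambda_u.k$ agents", calls itself at $u$, and, if $u\ne\Lambda_v.u_c$ and $d(v,\Lambda_u.u_l)\le d(r,v)+q$, adds "send an agent back from $\Lambda_u.u_l$ to $v$" (along the path in $T$). An instruction stands for the corresponding sequence of single moves; which of the agents present at its starting vertex perform it, and in which order, is left open. **Theorem.** There is an absolute constant $C$ such that for all $T$ and $q$ as above: 1. the list of instructions returned by CostExpl can be carried out, i.e. it describes at least one sequence of moves; 2. every sequence of moves that it describes is a strategy, explores $T$, and is cost-optimal; 3. CostExpl performs at most $C\,n$ elementary operations, i.e. it runs in $O(n)$ time, where reading or writing a cell of an array indexed by vertices, an arithmetic operation or comparison of numbers, a comparison of vertices, a test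 for the end of a list, and adding one instruction to the output count as one operation each, and allocating such an array counts $n$ operations. The computation of a table of the distances $d(r,v)$, from which the distances in the procedures are obtained by subtraction, is included in the count. -/

import Mathlib

/-! ## Edge-weighted rooted trees -/

/-- A tree with vertex set `V`, positive edge weights and a root (the homebase), given together with
the list of children of every vertex, in an arbitrary order. -/
structure WeightedTree (V : Type) where
  graph : SimpleGraph V
  isTree : graph.IsTree
  weight : Sym2 V → ℝ
  weight_pos : ∀ e ∈ graph.edgeSet, 0 < weight e
  root : V
  children : V → List V
  children_nodup : ∀ v, (children v).Nodup
  mem_children : ∀ v u, u ∈ children v ↔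
    graph.Adj v u ∧ graph.dist root u = graph.dist root v + 1

/-! ## Strategies, exploration and cost -/

/-- A single move. Agents are numbered `0, 1, 2, …` in the order in which they are invoked. -/
inductive Move (V : Type) where
  /-- a new agent is invoked in the homebase -/
  | invoke : Move V
  /-- agent `i` traverses an edge from `u` to `v` -/
  | traverse (i : ℕ) (u v : V) : Move V

namespace WeightedTree

variable {V : Type} (T : WeightedTree V)

/-- The positions of the agents after a move; entry `i` of the list is the position of agent `i`. -/
def after (pos : List V) : Move V → List V
  | .invoke => pos ++ [T.root]
  | .traverse i _ v => pos.set i v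

/-- A move is legal if it is an invocation, or if the moving agent has been invoked and stands at
one end of the edge that it traverses. -/
def LegalMove (pos : List V) : Move V → Prop
  | .invoke => True
  | .traverse i u v => pos[i]? = some u ∧ T.graph.Adj u v

/-- Every move of the sequence is legal when the moves are made one after another. -/
def LegalFrom : List V → List (Move V) → Prop
  | _, [] => True
  | pos, m :: S => T.LegalMove pos m ∧ LegalFrom (T.after pos m) S

/-- A strategy is a sequence of legal moves; at the beginning no agent has been invoked. -/
def IsStrategy (S : List (Move V)) : Prop := T.LegalFrom [] S

/-- The vertex at which the moving (or the invoked) agent stands after a move. -/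
def reached : Move V → V
  | .invoke => T.root
  | .traverse _ _ v => v

/-- Every vertex is visited by at least one agent. -/
def Explores (S : List (Move V)) : Prop := ∀ v, ∃ m ∈ S, T.reached m = v

/-- The contribution of a move to the distance traversed by agent `i`. -/
def moveLength (i : ℕ) : Move V → ℝ
  | .invoke => 0
  | .traverse j u v => if j = i then T.weight s(u, v) else 0

/-- The distance `d_i` traversed by agent `i`. -/
def agentDistance (S : List (Move V)) (i : ℕ) : ℝ := (S.map (T.moveLength i)).sum

end WeightedTree

/-- The contribution of a move to the number of agents. -/
def Move.invocations {V : Type} : Move V → ℕ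
  | .invoke => 1
  | .traverse _ _ _ => 0

/-- The number `k` of agents used by a strategy. -/
def numAgents {V : Type} (S : List (Move V)) : ℕ := (S.map Move.invocations).sum

namespace WeightedTree

variable {V : Type} (T : WeightedTree V)

/-- The cost `k q + ∑ d_i` of a strategy, for the invoking cost `q`. -/
noncomputable def cost (q : ℝ) (S : List (Move V)) : ℝ :=
  (numAgents S : ℝ) * q + ∑ i ∈ Finset.range (numAgents S), T.agentDistance S i

/-- `S` is a strategy that explores the tree, at the least cost among all such strategies. -/
def IsCostOptimal (q : ℝ) (S : List (Move V)) : Prop :=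
  T.IsStrategy S ∧ T.Explores S ∧
    ∀ S' : List (Move V), T.IsStrategy S' → T.Explores S' → T.cost q S ≤ T.cost q S'

end WeightedTree

/-! ## Sequences of moves as they are written by the procedures -/

/-- The lines `Add a move / a sequence of moves to S` of the procedures. -/
inductive Instr (V : Type) where
  /-- invoke `m` agents in the homebase -/
  | invoke (m : ℕ) : Instr V
  /-- traverse the edge from `u` to `v` by `m` agents -/
  | traverse (u v : V) (m : ℕ) : Instr V
  /-- send an agent back from `x` to `v` -/
  | sendBack (x v : V) : Instr V

namespace WeightedTree

variable {V : Type} (T : WeightedTree V)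

/-- The move sequences described by one instruction when the agents are in the positions `pos`.
Which of the agents present at the starting vertex perform it, and in which order, is left open. -/
def ExpandsInstr (pos : List V) : Instr V → List (Move V) → Prop
  | .invoke m, S => S = List.replicate m Move.invoke
  | .traverse u v m, S => ∃ A : List ℕ, A.Nodup ∧ A.length = m ∧ (∀ i ∈ A, pos[i]? = some u) ∧
      S = A.map fun i => Move.traverse i u v
  | .sendBack x v, S => ∃ (i : ℕ) (p : T.graph.Walk x v), pos[i]? = some x ∧ p.IsPath ∧
      S = p.darts.map fun d => Move.traverse i d.fst d.snd

/-- The move sequences described by a list of instructions, started from the positions `pos`. -/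
def Expands : List V → List (Instr V) → List (Move V) → Prop
  | _, [], S => S = []
  | pos, I :: L, S => ∃ S₁ S₂, S = S₁ ++ S₂ ∧ T.ExpandsInstr pos I S₁ ∧
      Expands (S₁.foldl T.after pos) L S₂

end WeightedTree

/-! ## Computations with a step count (unit-cost random access machine over the reals) -/

/-- The result of a computation together with the number of elementary operations performed. -/
structure Timed (α : Type) where
  val : α
  steps : ℕ

namespace Timed

/-- Running computations one after another adds up their numbers of steps. -/
instance : Monad Timed where
  pure a := ⟨a, 0⟩
  bind x f := ⟨(f x.val).val, x.steps + (f x.val).steps⟩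

/-- One elementary operation with result `x`: reading or writing one array cell, one arithmetic
operation or comparison of numbers, one comparison of vertices, one test for the empty list, or
adding one instruction to the output. -/
def op {α : Type} (x : α) : Timed α := ⟨x, 1⟩

/-- Allocation of an array indexed by the vertices, at one step per cell. -/
def alloc (V : Type) [Fintype V] {α : Type} (x : α) : Timed (V → α) := ⟨fun _ => x, Fintype.card V⟩

/-- The loop `for all a ∈ l`, with loop state `s` and body `f`. Every test of the loop for the
end of the list is one step. -/
def forEach {α σ : Type} : (l : List α) → (s : σ) → ((a : α) → a ∈ l → σ → Timed σ) → Timed σ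
  | [], s, _ => op s
  | a :: l, s, f => do
      let s ← op s
      let s ← f a List.mem_cons_self s
      forEach l s fun b hb => f b (List.mem_cons_of_mem a hb)

end Timed

/-! ## The procedures -/

/-- The label `(k, u_l, u_c)` of a vertex; `none` stands for `null`. -/
structure Label (V : Type) where
  k : ℕ
  ul : V
  uc : Option V

namespace WeightedTree

open Timed

variable {V : Type} (T : WeightedTree V)

/-- Children are farther from the root, and all vertices are less than `|V|` edges away. -/
theorem measure_lt [Fintype V] {v u : V} (h : u ∈ T.children v) :
    Fintype.card V - T.graph.dist T.root u < Fintype.card V - T.graph.dist T.root v := by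
  have h1 := ((T.mem_children v u).1 h).2
  obtain ⟨p, hp, hl⟩ := T.isTree.connected.exists_path_of_dist T.root u
  have h2 := hp.length_lt
  omega

/-- Given that `D v` holds the distance `d(r, v)`, stores `d(r, x)` in `D x` for all `x` below `v`. -/
noncomputable def setDistances [Fintype V] [DecidableEq V] (v : V) (D : V → ℝ) :
    Timed (V → ℝ) :=
  forEach (T.children v) D fun u _hu D => do
    let dv ← op (D v)
    let w ← op (T.weight s(v, u))
    let du ← op (dv + w)
    let D ← op (Function.update D u du)
    setDistances u D
termination_by Fintype.card V - T.graph.dist T.root v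
decreasing_by exact T.measure_lt _hu

/-- The procedure `SetLabeling` for the vertex `v`. The array `D` holds the distances from the root,
so that `d(v, x) = D x - D v` for every vertex `x` below `v`. -/
noncomputable def setLabeling [Fintype V] [DecidableEq V] (q : ℝ) (D : V → ℝ)
    (v : V) (Λ : V → Label V) : Timed (V → Label V) := do
  let isLeaf ← op (T.children v).isEmpty
  if isLeaf then
    op (Function.update Λ v ⟨1, v, none⟩)
  else
    let Λ ← forEach (T.children v) Λ fun u _hu Λ => setLabeling q D u Λ
    let dv ← op (D v)
    let dr ← op (dv + q)
    let (k, _, uc) ← forEach (T.children v) ((0, 0, none) : ℕ × ℝ × Option V)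
      fun u _ (k, dmax, uc) => do
        let lab ← op (Λ u)
        let k ← op (k + lab.k)
        let dl ← op (D lab.ul)
        let d ← op (dl - dv)
        let single ← op (decide (lab.k = 1))
        let near ← op (decide (d ≤ dr))
        let k ← op (if single && near then k - 1 else k)
        let farther ← op (decide (dmax < d))
        if farther then op (k, d, some u) else op (k, dmax, uc)
    let k ← op (max 1 k)
    match uc with
    | none => pure Λ
    | some u => do
        let lab ← op (Λ u)
        op (Function.update Λ v ⟨k, lab.ul, some u⟩)
termination_by Fintype.card V - T.graph.dist T.root v
decreasing_by exact T.measure_lt _hu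

/-- The procedure `SetStrategy` for the vertex `v`. The children other than `Λ_v.u_c` are handled in
the first pass over the list of children, and `Λ_v.u_c` in the second one. -/
noncomputable def setStrategy [Fintype V] [DecidableEq V] (q : ℝ) (D : V → ℝ)
    (Λ : V → Label V) (v : V) (S : List (Instr V)) :
    Timed (List (Instr V)) := do
  let isLeaf ← op (T.children v).isEmpty
  if isLeaf then
    pure S
  else
    let lv ← op (Λ v)
    let isRoot ← op (decide (v = T.root))
    let S ← if isRoot then op (S ++ [Instr.invoke lv.k]) else pure S
    let dv ← op (D v)
    let dr ← op (dv + q)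
    forEach [false, true] S fun lastPass _ S =>
      forEach (T.children v) S fun u _hu S => do
        let isLast ← op (decide (lv.uc = some u))
        if isLast = lastPass then
          let lab ← op (Λ u)
          let S ← op (S ++ [Instr.traverse v u lab.k])
          let S ← setStrategy q D Λ u S
          let dl ← op (D lab.ul)
          let d ← op (dl - dv)
          let near ← op (decide (d ≤ dr))
          if near && !isLast then op (S ++ [Instr.sendBack lab.ul v]) else pure S
        else
          pure S
termination_by Fintype.card V - T.graph.dist T.root v
decreasing_by exact T.measure_lt _hu

/-- The procedure `CostExpl`: first the labeling is computed by `SetLabeling`, then the strategy is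
computed from it by `SetStrategy`. The distances from the root, which both procedures use, are
tabulated beforehand, and the time for this is counted. -/
noncomputable def costExpl [Fintype V] [DecidableEq V] (q : ℝ) : Timed (List (Instr V)) := do
  let D ← alloc V (0 : ℝ)
  let D ← T.setDistances T.root D
  let Λ ← alloc V (⟨0, T.root, none⟩ : Label V)
  let Λ ← T.setLabeling q D T.root Λ
  T.setStrategy q D Λ T.root []

end WeightedTree

/-!
The recursion `serve v = depth v + q` for a leaf, and for an inner vertex
`serve v = ∑ min (2 * branchWeight u) (serve u) + max 0 (2 * depth v + q - maxDepth v)` over the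
children `u` of `v`, describes the least cost of exploring the subtree of `v` by agents of its own:
the branch at a child is either traversed twice by an agent that returns, or gets agents of its own.
The choice of the minimum is governed by the comparison of `maxDepth u - depth v` with `depth v + q`
that the procedures make, so the computed instructions cost exactly `serve root`.

For the lower bound, let `n v` be the number of agents that are in the subtree of `v` at the end of
an arbitrary exploring strategy. The edge above `v` is traversed at least `n v` times, and at least
twice if `n v = 0`, since then every agent that enters the subtree leaves it again. The sum of these
bounds over all edges, together with the invoking cost `n root * q`, is at least `serve root` by
induction from the leaves to the root.
-/

namespace WeightedTree

/-! ## Root paths and descendants -/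

section Tree

variable {V : Type} (T : WeightedTree V)

theorem adj_of_mem_children {v u : V} (h : u ∈ T.children v) : T.graph.Adj v u :=
  ((T.mem_children v u).1 h).1

theorem dist_of_mem_children {v u : V} (h : u ∈ T.children v) :
    T.graph.dist T.root u = T.graph.dist T.root v + 1 :=
  ((T.mem_children v u).1 h).2

theorem ne_of_mem_children {v u : V} (h : u ∈ T.children v) : u ≠ v :=
  (T.adj_of_mem_children h).ne'

theorem ne_root_of_mem_children {v u : V} (h : u ∈ T.children v) : u ≠ T.root := by
  rintro rfl
  simpa using T.dist_of_mem_children h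

theorem mem_children_or_mem_children_of_adj {u v : V} (h : T.graph.Adj u v) :
    v ∈ T.children u ∨ u ∈ T.children v := by
  simp only [T.mem_children, h, h.symm, true_and]
  have hne := T.isTree.dist_ne_of_adj T.root h
  have hdiff := h.diff_dist_adj (u := T.root)
  omega

theorem children_root_ne_nil [Nontrivial V] : T.children T.root ≠ [] := by
  obtain ⟨x, hx⟩ := T.isTree.connected.preconnected.exists_adj_of_nontrivial T.root
  have hmem := (T.mem_children_or_mem_children_of_adj hx).resolve_right fun hroot =>
    T.ne_root_of_mem_children hroot rfl
  exact List.ne_nil_of_mem hmem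

theorem exists_mem_children {v : V} (h : v ≠ T.root) : ∃ x, v ∈ T.children x := by
  obtain ⟨p, hp⟩ := T.isTree.connected.exists_walk_length_eq_dist T.root v
  have hnil : ¬ p.Nil := fun hnil => h hnil.eq.symm
  have hadj := p.adj_penultimate hnil
  refine ⟨p.penultimate, (T.mem_children_or_mem_children_of_adj hadj).resolve_right fun hmem => ?_⟩
  have hlt := T.dist_of_mem_children hmem
  have hle : T.graph.dist T.root p.penultimate ≤ p.dropLast.length := SimpleGraph.dist_le _
  have hlen := p.length_dropLast
  omega

@[elab_as_elim]
theorem parent_induction {P : V → Prop} (root : P T.root)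
    (child : ∀ v, ∀ u ∈ T.children v, P v → P u) (v : V) : P v := by
  induction hn : T.graph.dist T.root v generalizing v with
  | zero => exact (T.isTree.connected.dist_eq_zero_iff.1 hn) ▸ root
  | succ n ih =>
    obtain ⟨x, hx⟩ := T.exists_mem_children (v := v) (by rintro rfl; simp at hn)
    exact child x v hx (ih x (by have := T.dist_of_mem_children hx; omega))

@[elab_as_elim]
theorem child_induction [Finite V] {P : V → Prop} (h : ∀ v, (∀ u ∈ T.children v, P u) → P v)
    (v : V) : P v := by
  cases nonempty_fintype V
  exact (measure fun v => Fintype.card V - T.graph.dist T.root v).wf.induction v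
    fun v ih => h v fun u hu => ih u (T.measure_lt hu)

/-- The path in the tree from the root to `v`. -/
noncomputable def rootPath (v : V) : T.graph.Walk T.root v :=
  (T.isTree.existsUnique_path T.root v).choose

theorem isPath_rootPath (v : V) : (T.rootPath v).IsPath :=
  (T.isTree.existsUnique_path T.root v).choose_spec.1

theorem rootPath_eq {v : V} {p : T.graph.Walk T.root v} (hp : p.IsPath) : T.rootPath v = p :=
  (T.isTree.existsUnique_path T.root v).unique (T.isPath_rootPath v) hp

theorem rootPath_root : T.rootPath T.root = .nil := T.rootPath_eq .nil

theorem length_rootPath (v : V) : (T.rootPath v).length = T.graph.dist T.root v := by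
  obtain ⟨p, hp⟩ := T.isTree.connected.exists_walk_length_eq_dist T.root v
  rw [T.rootPath_eq (p.isPath_of_length_eq_dist hp), hp]

theorem rootPath_of_mem_children {v u : V} (h : u ∈ T.children v) :
    T.rootPath u = (T.rootPath v).concat (T.adj_of_mem_children h) := by
  refine T.rootPath_eq (SimpleGraph.Walk.isPath_of_length_eq_dist _ ?_)
  rw [SimpleGraph.Walk.length_concat, length_rootPath, T.dist_of_mem_children h]

/-- The parent of a vertex. The root is its own parent. -/
noncomputable def parent (v : V) : V := (T.rootPath v).penultimate

theorem parent_of_mem_children {v u : V} (h : u ∈ T.children v) : T.parent u = v := by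
  rw [parent, T.rootPath_of_mem_children h, SimpleGraph.Walk.penultimate_concat]

theorem parent_root : T.parent T.root = T.root := by
  rw [parent, rootPath_root, SimpleGraph.Walk.penultimate_nil]

/-- The vertices of the subtree of `v`, listed in depth-first order. -/
def descendants [Fintype V] (v : V) : List V :=
  v :: (T.children v).attach.flatMap fun u => descendants u.1
termination_by Fintype.card V - T.graph.dist T.root v
decreasing_by exact T.measure_lt u.2

section Descendants

variable [Fintype V]

theorem descendants_eq (v : V) :
    T.descendants v = v :: (T.children v).flatMap T.descendants := by
  rw [descendants]
  simp

theorem mem_descendants {v x : V} :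
    x ∈ T.descendants v ↔ x = v ∨ ∃ u ∈ T.children v, x ∈ T.descendants u := by
  rw [descendants_eq, List.mem_cons, List.mem_flatMap]

theorem mem_descendants_self (v : V) : v ∈ T.descendants v := T.mem_descendants.2 (.inl rfl)

theorem mem_descendants_of_child {v u x : V} (hu : u ∈ T.children v)
    (hx : x ∈ T.descendants u) : x ∈ T.descendants v :=
  T.mem_descendants.2 (.inr ⟨u, hu, hx⟩)

theorem exists_rootPath_eq_append {v x : V} (h : x ∈ T.descendants v) :
    ∃ p : T.graph.Walk v x, T.rootPath x = (T.rootPath v).append p := by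
  induction v using T.child_induction with
  | _ v ih =>
    rcases T.mem_descendants.1 h with rfl | ⟨u, hu, hx⟩
    · exact ⟨.nil, (SimpleGraph.Walk.append_nil _).symm⟩
    · obtain ⟨p, hp⟩ := ih u hu hx
      exact ⟨.cons (T.adj_of_mem_children hu) p, by
        rw [hp, T.rootPath_of_mem_children hu, SimpleGraph.Walk.concat_append]⟩

theorem child_mem_descendants {v y u : V} (hy : y ∈ T.descendants v) (hu : u ∈ T.children y) :
    u ∈ T.descendants v := by
  induction v using T.child_induction with
  | _ v ih =>
    rcases T.mem_descendants.1 hy with rfl | ⟨w, hw, hyw⟩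
    · exact T.mem_descendants_of_child hu (T.mem_descendants_self u)
    · exact T.mem_descendants_of_child hw (ih w hw hyw)

theorem mem_descendants_iff_mem_support {v x : V} :
    x ∈ T.descendants v ↔ v ∈ (T.rootPath x).support := by
  constructor
  · intro h
    obtain ⟨p, hp⟩ := T.exists_rootPath_eq_append h
    rw [hp]
    exact (SimpleGraph.Walk.mem_support_append_iff _ _).2
      (.inl (SimpleGraph.Walk.end_mem_support _))
  · induction x using T.parent_induction with
    | root =>
      rw [rootPath_root, SimpleGraph.Walk.mem_support_nil_iff]
      rintro rfl
      exact T.mem_descendants_self _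
    | child y u hu ih =>
      rw [T.rootPath_of_mem_children hu, SimpleGraph.Walk.support_concat, List.mem_append,
        List.mem_singleton]
      rintro (hy | rfl)
      · exact T.child_mem_descendants (ih hy) hu
      · exact T.mem_descendants_self _

theorem mem_descendants_of_mem_children_iff {v y u : V} (hu : u ∈ T.children y) :
    u ∈ T.descendants v ↔ y ∈ T.descendants v ∨ u = v := by
  simp only [mem_descendants_iff_mem_support, T.rootPath_of_mem_children hu,
    SimpleGraph.Walk.support_concat, List.mem_append, List.mem_singleton, eq_comm]

theorem mem_descendants_root (x : V) : x ∈ T.descendants T.root :=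
  T.mem_descendants_iff_mem_support.2 (SimpleGraph.Walk.start_mem_support _)

theorem getVert_rootPath {v x : V} (h : x ∈ T.descendants v) :
    (T.rootPath x).getVert (T.graph.dist T.root v) = v := by
  obtain ⟨p, hp⟩ := T.exists_rootPath_eq_append h
  rw [hp, ← length_rootPath, SimpleGraph.Walk.getVert_append]
  simp

theorem eq_of_mem_descendants {v u u' x : V} (hu : u ∈ T.children v) (hu' : u' ∈ T.children v)
    (h : x ∈ T.descendants u) (h' : x ∈ T.descendants u') : u = u' := by
  rw [← T.getVert_rootPath h, ← T.getVert_rootPath h', T.dist_of_mem_children hu,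
    T.dist_of_mem_children hu']

theorem notMem_descendants_child {v u : V} (hu : u ∈ T.children v) : v ∉ T.descendants u := by
  intro h
  obtain ⟨p, hp⟩ := T.exists_rootPath_eq_append h
  have hlen := congrArg SimpleGraph.Walk.length hp
  rw [SimpleGraph.Walk.length_append, length_rootPath, length_rootPath,
    T.dist_of_mem_children hu] at hlen
  omega

theorem nodup_descendants (v : V) : (T.descendants v).Nodup := by
  induction v using T.child_induction with
  | _ v ih =>
    rw [descendants_eq, List.nodup_cons, List.nodup_flatMap]
    refine ⟨?_, ih, (T.children_nodup v).pairwise_of_forall_ne fun u hu u' hu' hne x hx hx' =>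
      hne (T.eq_of_mem_descendants hu hu' hx hx')⟩
    simp only [List.mem_flatMap, not_exists, not_and]
    exact fun u hu => T.notMem_descendants_child hu

theorem length_descendants (v : V) :
    (T.descendants v).length =
      1 + ((T.children v).map fun u => (T.descendants u).length).sum := by
  rw [descendants_eq, List.length_cons, List.length_flatMap, add_comm]

theorem length_descendants_root_le : (T.descendants T.root).length ≤ Fintype.card V :=
  (T.nodup_descendants _).length_le_card

/-- The sum of `g` over the subtree of `v`. -/
def subtreeSum {M : Type*} [AddCommMonoid M] (g : V → M) (v : V) : M :=
  ((T.descendants v).map g).sum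

theorem subtreeSum_eq {M : Type*} [AddCommMonoid M] (g : V → M) (v : V) :
    T.subtreeSum g v = g v + ((T.children v).map (T.subtreeSum g)).sum := by
  rw [subtreeSum, descendants_eq, List.map_cons, List.sum_cons, List.map_flatMap, List.flatMap,
    List.sum_flatten, List.map_map]
  rfl

theorem subtreeSum_root {M : Type*} [AddCommMonoid M] (g : V → M) :
    T.subtreeSum g T.root = ∑ x, g x := by
  classical
  rw [subtreeSum, ← List.sum_toFinset _ (T.nodup_descendants _)]
  exact Finset.sum_congr (Finset.ext fun x => by simp [T.mem_descendants_root x]) fun _ _ => rfl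

end Descendants

/-! ## Depth -/

/-- The total weight of the edges of a walk. -/
def walkWeight {u v : V} (p : T.graph.Walk u v) : ℝ := (p.edges.map T.weight).sum

theorem walkWeight_nonneg {u v : V} (p : T.graph.Walk u v) : 0 ≤ T.walkWeight p := by
  refine List.sum_nonneg fun x hx => ?_
  obtain ⟨e, he, rfl⟩ := List.mem_map.1 hx
  exact (T.weight_pos e (p.edges_subset_edgeSet he)).le

/-- The weighted distance `d(r, v)` from the root. -/
noncomputable def depth (v : V) : ℝ := T.walkWeight (T.rootPath v)

/-- The weight of the edge from `v` to its parent; zero at the root. -/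
noncomputable def parentWeight (v : V) : ℝ := T.depth v - T.depth (T.parent v)

theorem depth_nonneg (v : V) : 0 ≤ T.depth v := T.walkWeight_nonneg _

theorem depth_root : T.depth T.root = 0 := by
  rw [depth, rootPath_root]
  rfl

theorem depth_of_mem_children {v u : V} (h : u ∈ T.children v) :
    T.depth u = T.depth v + T.weight s(v, u) := by
  simp [depth, walkWeight, T.rootPath_of_mem_children h, SimpleGraph.Walk.edges_concat]

theorem depth_lt_of_mem_children {v u : V} (h : u ∈ T.children v) : T.depth v < T.depth u := by
  rw [T.depth_of_mem_children h]
  exact lt_add_of_pos_right _ (T.weight_pos _ (T.adj_of_mem_children h))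

theorem parentWeight_of_mem_children {v u : V} (h : u ∈ T.children v) :
    T.parentWeight u = T.weight s(v, u) := by
  rw [parentWeight, T.parent_of_mem_children h, T.depth_of_mem_children h, add_sub_cancel_left]

theorem parentWeight_root : T.parentWeight T.root = 0 := by
  rw [parentWeight, parent_root, sub_self]

theorem parentWeight_pos {v u : V} (h : u ∈ T.children v) : 0 < T.parentWeight u := by
  rw [parentWeight, T.parent_of_mem_children h]
  exact sub_pos.2 (T.depth_lt_of_mem_children h)

theorem parentWeight_nonneg (v : V) : 0 ≤ T.parentWeight v := by
  rcases eq_or_ne v T.root with rfl | h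
  · rw [parentWeight_root]
  · obtain ⟨x, hx⟩ := T.exists_mem_children h
    exact (T.parentWeight_pos hx).le

theorem exists_path_of_mem_descendants [Fintype V] {v x : V} (h : x ∈ T.descendants v) :
    ∃ p : T.graph.Walk v x, p.IsPath ∧ T.depth x = T.depth v + T.walkWeight p := by
  obtain ⟨p, hp⟩ := T.exists_rootPath_eq_append h
  refine ⟨p, (hp ▸ T.isPath_rootPath x).of_append_right, ?_⟩
  rw [depth, depth, hp]
  simp only [walkWeight, SimpleGraph.Walk.edges_append, List.map_append, List.sum_append]

theorem depth_le_of_mem_descendants [Fintype V] {v x : V} (h : x ∈ T.descendants v) :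
    T.depth v ≤ T.depth x := by
  obtain ⟨p, -, hp⟩ := T.exists_path_of_mem_descendants h
  linarith [T.walkWeight_nonneg p]

theorem root_notMem_descendants [Fintype V] {c : V} (hc : c ≠ T.root) :
    T.root ∉ T.descendants c := by
  obtain ⟨x, hx⟩ := T.exists_mem_children hc
  intro h
  have hle := T.depth_le_of_mem_descendants h
  have hlt := T.depth_lt_of_mem_children hx
  linarith [T.depth_root, T.depth_nonneg x]

end Tree

end WeightedTree

/-! ## Running time -/

namespace Timed

variable {α β σ : Type}

@[simp] theorem val_bind (x : Timed α) (f : α → Timed β) :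
    (x >>= f).val = (f x.val).val := rfl

@[simp] theorem steps_bind (x : Timed α) (f : α → Timed β) :
    (x >>= f).steps = x.steps + (f x.val).steps := rfl

@[simp] theorem val_pure (a : α) : (pure a : Timed α).val = a := rfl

@[simp] theorem steps_pure (a : α) : (pure a : Timed α).steps = 0 := rfl

@[simp] theorem val_op (a : α) : (op a).val = a := rfl

@[simp] theorem steps_op (a : α) : (op a).steps = 1 := rfl

@[simp] theorem val_op_bind (a : α) (f : α → Timed β) : (op a >>= f).val = (f a).val := rfl

@[simp] theorem steps_op_bind (a : α) (f : α → Timed β) :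
    (op a >>= f).steps = 1 + (f a).steps := rfl

theorem val_forEach (l : List α) (s : σ) (f : α → σ → Timed σ) :
    (forEach l s fun a _ s => f a s).val = l.foldl (fun s a => (f a s).val) s := by
  induction l generalizing s with
  | nil => rfl
  | cons a l ih => simp only [forEach, val_bind, val_op, List.foldl_cons, ih]

theorem steps_forEach_add_le {l : List α} {f : α → σ → Timed σ} {b : ℕ} {c : α → ℕ}
    (h : ∀ a ∈ l, ∀ s, (f a s).steps + 1 + b ≤ c a) (s : σ) :
    (forEach l s fun a _ s => f a s).steps + b * l.length ≤ 1 + (l.map c).sum := by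
  induction l generalizing s with
  | nil => simp [forEach]
  | cons a l ih =>
    simp only [forEach, steps_bind, steps_op, val_op, List.map_cons, List.sum_cons,
      List.length_cons, mul_add, mul_one]
    have hhead := h a List.mem_cons_self s
    have htail := ih (fun b hb => h b (List.mem_cons_of_mem a hb)) (f a s).val
    omega

end Timed

namespace WeightedTree

open Timed

section Bodies

variable {V : Type}

/-- The body of the second loop of `setLabeling`, which computes the label of `v` from the labels
of its children. -/
noncomputable def labelBody (q : ℝ) (D : V → ℝ) (Λ : V → Label V) (v u : V)
    (s : ℕ × ℝ × Option V) : Timed (ℕ × ℝ × Option V) := do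
  let lab ← op (Λ u)
  let k ← op (s.1 + lab.k)
  let dl ← op (D lab.ul)
  let d ← op (dl - D v)
  let single ← op (decide (lab.k = 1))
  let near ← op (decide (d ≤ D v + q))
  let k ← op (if single && near then k - 1 else k)
  let farther ← op (decide (s.2.1 < d))
  if farther then op (k, d, some u) else op (k, s.2.1, s.2.2)

/-- The last lines of `setLabeling`, by which the label of `v` is stored. -/
noncomputable def storeLabel [DecidableEq V] (Λ : V → Label V) (v : V) (s : ℕ × ℝ × Option V) :
    Timed (V → Label V) := do
  let k ← op (max 1 s.1)
  match s.2.2 with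
  | none => pure Λ
  | some u => do
      let lab ← op (Λ u)
      op (Function.update Λ v ⟨k, lab.ul, some u⟩)

theorem steps_labelBody (q : ℝ) (D : V → ℝ) (Λ : V → Label V) (v u : V)
    (s : ℕ × ℝ × Option V) : (labelBody q D Λ v u s).steps = 9 := by
  simp only [labelBody, steps_op_bind]
  split <;> rfl

theorem steps_storeLabel_le [DecidableEq V] (Λ : V → Label V) (v : V) (s : ℕ × ℝ × Option V) :
    (storeLabel Λ v s).steps ≤ 3 := by
  obtain ⟨k, dmax, _ | _⟩ := s <;> simp [storeLabel]

end Bodies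

section RunningTime

variable {V : Type} (T : WeightedTree V) [Fintype V] [DecidableEq V]

theorem setDistances_eq (v : V) (D : V → ℝ) :
    T.setDistances v D = forEach (T.children v) D (fun u _ D => do
      let dv ← op (D v)
      let w ← op (T.weight s(v, u))
      let du ← op (dv + w)
      let D ← op (Function.update D u du)
      T.setDistances u D) := by
  rw [setDistances]

/-- The body of the two passes of `setStrategy` over the children of `v`. -/
noncomputable def strategyBody (q : ℝ) (D : V → ℝ) (Λ : V → Label V) (v : V) (lastPass : Bool)
    (u : V) (S : List (Instr V)) : Timed (List (Instr V)) := do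
  let isLast ← op (decide ((Λ v).uc = some u))
  if isLast = lastPass then
    let lab ← op (Λ u)
    let S ← op (S ++ [Instr.traverse v u lab.k])
    let S ← T.setStrategy q D Λ u S
    let dl ← op (D lab.ul)
    let d ← op (dl - D v)
    let near ← op (decide (d ≤ D v + q))
    if near && !isLast then op (S ++ [Instr.sendBack lab.ul v]) else pure S
  else
    pure S

theorem setLabeling_leaf (q : ℝ) (D : V → ℝ) {v : V} (Λ : V → Label V) (h : T.children v = []) :
    T.setLabeling q D v Λ = op () >>= fun _ => op (Function.update Λ v ⟨1, v, none⟩) := by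
  rw [setLabeling, h]
  rfl

theorem setLabeling_node (q : ℝ) (D : V → ℝ) {v : V} (Λ : V → Label V) (h : T.children v ≠ []) :
    T.setLabeling q D v Λ = op () >>= fun _ =>
      (forEach (T.children v) Λ fun u _ Λ => T.setLabeling q D u Λ) >>= fun Λ =>
      op () >>= fun _ => op () >>= fun _ =>
      (forEach (T.children v) (0, 0, none) fun u _ s => labelBody q D Λ v u s) >>=
      storeLabel Λ v := by
  rw [setLabeling, List.isEmpty_eq_false_iff.2 h]
  rfl

theorem setStrategy_leaf (q : ℝ) (D : V → ℝ) (Λ : V → Label V) {v : V} (S : List (Instr V))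
    (h : T.children v = []) : T.setStrategy q D Λ v S = op () >>= fun _ => pure S := by
  rw [setStrategy, h]
  rfl

theorem setStrategy_node (q : ℝ) (D : V → ℝ) (Λ : V → Label V) {v : V} (S : List (Instr V))
    (h : T.children v ≠ []) : T.setStrategy q D Λ v S = op () >>= fun _ => op () >>= fun _ =>
      op () >>= fun _ =>
      (if v = T.root then op (S ++ [Instr.invoke (Λ v).k]) else pure S) >>= fun S =>
      op () >>= fun _ => op () >>= fun _ =>
      (forEach [false, true] S fun b _ S =>
        forEach (T.children v) S fun u _ S => T.strategyBody q D Λ v b u S) := by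
  rw [setStrategy, List.isEmpty_eq_false_iff.2 h]
  by_cases hv : v = T.root
  · simp only [hv, decide_true, if_true]
    rfl
  · simp only [hv, decide_false, if_false]
    rfl

theorem steps_strategyBody_le (q : ℝ) (D : V → ℝ) (Λ : V → Label V) (v : V) (b : Bool) {u : V}
    {c : ℕ} (hc : ∀ S, (T.setStrategy q D Λ u S).steps ≤ c) (S : List (Instr V)) :
    (T.strategyBody q D Λ v b u S).steps ≤
      if decide ((Λ v).uc = some u) = b then 7 + c else 1 := by
  simp only [strategyBody, steps_op_bind]
  have hrec := hc (S ++ [Instr.traverse v u (Λ u).k])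
  split
  · simp only [steps_op_bind, steps_bind (T.setStrategy _ _ _ _ _)]
    split <;> simp only [steps_op, steps_pure] <;> omega
  · simp

theorem steps_setDistances_add_le (v : V) (D : V → ℝ) :
    (T.setDistances v D).steps + 5 ≤ 6 * (T.descendants v).length := by
  induction v using T.child_induction generalizing D with
  | _ v ih =>
    have hloop := steps_forEach_add_le (l := T.children v) (b := 0)
      (c := fun u => 6 * (T.descendants u).length)
      (f := fun u D => op (D v) >>= fun dv => op (T.weight s(v, u)) >>= fun w =>
        op (dv + w) >>= fun du => op (Function.update D u du) >>= fun D => T.setDistances u D)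
      (fun u hu D => by
        have := ih u hu (Function.update D u (D v + T.weight s(v, u)))
        simp only [steps_bind, steps_op, val_op]
        omega) D
    rw [List.sum_map_mul_left] at hloop
    rw [setDistances_eq, length_descendants]
    omega

theorem steps_setLabeling_add_le (q : ℝ) (D : V → ℝ) (v : V) (Λ : V → Label V) :
    (T.setLabeling q D v Λ).steps + 11 ≤ 19 * (T.descendants v).length := by
  induction v using T.child_induction generalizing Λ with
  | _ v ih =>
    rw [length_descendants]
    by_cases h : T.children v = []
    · rw [T.setLabeling_leaf q D Λ h]
      simp [h]
    · rw [T.setLabeling_node q D Λ h]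
      simp only [steps_bind, steps_op]
      have hlabels := steps_forEach_add_le (b := 10) (fun u hu Λ => ih u hu Λ) Λ
      rw [List.sum_map_mul_left] at hlabels
      set Λ' := (forEach (T.children v) Λ fun u _ Λ => T.setLabeling q D u Λ).val
      have hloop := steps_forEach_add_le (l := T.children v) (b := 0) (c := fun _ => 10)
        (fun u _ s => (congrArg (· + 1) (steps_labelBody q D Λ' v u s)).le) (0, 0, none)
      rw [List.map_const', List.sum_replicate, smul_eq_mul] at hloop
      have hstore := steps_storeLabel_le Λ' v
        (forEach (T.children v) (0, 0, none) fun u _ s => labelBody q D Λ' v u s).val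
      omega

theorem steps_setStrategy_add_le (q : ℝ) (D : V → ℝ) (Λ : V → Label V) (v : V)
    (S : List (Instr V)) :
    (T.setStrategy q D Λ v S).steps + 11 ≤ 22 * (T.descendants v).length := by
  induction v using T.child_induction generalizing S with
  | _ v ih =>
    rw [length_descendants]
    by_cases h : T.children v = []
    · rw [T.setStrategy_leaf q D Λ S h]
      simp [h]
    · let c (b : Bool) (u : V) : ℕ :=
        if decide ((Λ v).uc = some u) = b then 22 * (T.descendants u).length else 4
      have hpass (b : Bool) := steps_forEach_add_le (l := T.children v) (b := 2) (c := c b)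
        (f := T.strategyBody q D Λ v b) fun u hu S => by
          have hbody := T.steps_strategyBody_le q D Λ v b
            (fun S => Nat.le_sub_of_add_le (ih u hu S)) S
          have := ih u hu S
          simp only [c]
          split_ifs at hbody ⊢ <;> omega
      have hpasses : ((T.children v).map (c false)).sum + ((T.children v).map (c true)).sum =
          22 * ((T.children v).map fun u => (T.descendants u).length).sum +
            4 * (T.children v).length := by
        have hc (u : V) : c false u + c true u = 22 * (T.descendants u).length + 4 := by
          by_cases hu : (Λ v).uc = some u <;> simp [c, hu, add_comm]
        rw [← List.sum_map_add]
        simp only [hc, List.sum_map_add, List.sum_map_mul_left, List.map_const',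
          List.sum_replicate, smul_eq_mul, mul_comm]
      have hinvoke : (if v = T.root then op (S ++ [Instr.invoke (Λ v).k])
          else pure S : Timed _).steps ≤ 1 := by split <;> simp
      rw [T.setStrategy_node q D Λ S h]
      simp only [forEach, steps_bind, steps_op, val_op]
      set S' := (if v = T.root then op (S ++ [Instr.invoke (Λ v).k]) else pure S : Timed _).val
      have hfirst := hpass false S'
      have hsecond := hpass true
        (forEach (T.children v) S' fun u _ S => T.strategyBody q D Λ v false u S).val
      omega

theorem steps_costExpl_le (q : ℝ) : (T.costExpl q).steps ≤ 49 * Fintype.card V := by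
  have hdist := T.steps_setDistances_add_le T.root
  have hlabel := T.steps_setLabeling_add_le q
  have hstrat := T.steps_setStrategy_add_le q
  have hcard := T.length_descendants_root_le
  simp only [costExpl, steps_bind]
  grind [alloc]

end RunningTime

/-! ## Labels -/

section Labels

variable {V : Type} (T : WeightedTree V) [Fintype V]

/-- The depth of the deepest vertex of the subtree of `v`. -/
noncomputable def maxDepth (v : V) : ℝ := ⨆ x : {x // x ∈ T.descendants v}, T.depth x

theorem depth_le_maxDepth {v x : V} (h : x ∈ T.descendants v) : T.depth x ≤ T.maxDepth v :=
  le_ciSup (f := fun x : {x // x ∈ T.descendants v} => T.depth x)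
    (Set.finite_range _).bddAbove ⟨x, h⟩

theorem exists_depth_eq_maxDepth (v : V) : ∃ x ∈ T.descendants v, T.depth x = T.maxDepth v := by
  have : Nonempty {x // x ∈ T.descendants v} := ⟨v, T.mem_descendants_self v⟩
  obtain ⟨⟨x, hx⟩, h⟩ :=
    exists_eq_ciSup_of_finite (f := fun x : {x // x ∈ T.descendants v} => T.depth x)
  exact ⟨x, hx, h⟩

theorem maxDepth_le_of_mem_children {v u : V} (hu : u ∈ T.children v) :
    T.maxDepth u ≤ T.maxDepth v := by
  obtain ⟨x, hx, h⟩ := T.exists_depth_eq_maxDepth u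
  exact h ▸ T.depth_le_maxDepth (T.mem_descendants_of_child hu hx)

/-- The first of the children of `v` with a deepest subtree: the entry `u_c` of the label of `v`. -/
noncomputable def lastChild (v : V) : Option V := (T.children v).argmax T.maxDepth

theorem lastChild_mem {v w : V} (h : T.lastChild v = some w) : w ∈ T.children v :=
  List.argmax_mem h

theorem lastChild_eq_none {v : V} : T.lastChild v = none ↔ T.children v = [] :=
  List.argmax_eq_none

theorem exists_lastChild {v : V} (h : T.children v ≠ []) : ∃ w, T.lastChild v = some w :=
  Option.ne_none_iff_exists'.1 (mt T.lastChild_eq_none.1 h)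

theorem maxDepth_of_children_eq_nil {v : V} (h : T.children v = []) :
    T.maxDepth v = T.depth v := by
  obtain ⟨x, hx, hmax⟩ := T.exists_depth_eq_maxDepth v
  rw [descendants_eq, h, List.flatMap_nil, List.mem_singleton] at hx
  rw [← hmax, hx]

theorem maxDepth_of_lastChild {v w : V} (h : T.lastChild v = some w) :
    T.maxDepth v = T.maxDepth w := by
  refine le_antisymm ?_ (T.maxDepth_le_of_mem_children (T.lastChild_mem h))
  obtain ⟨x, hx, hmax⟩ := T.exists_depth_eq_maxDepth v
  rw [← hmax]
  rcases T.mem_descendants.1 hx with rfl | ⟨u, hu, hxu⟩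
  · exact (T.depth_le_of_mem_descendants (T.mem_descendants_of_child (T.lastChild_mem h)
      (T.mem_descendants_self w))).trans (T.depth_le_maxDepth (T.mem_descendants_self w))
  · exact (T.depth_le_maxDepth hxu).trans (List.le_of_mem_argmax hu h)

/-- The deepest vertex below `v` that is reached by following the last children: the entry `u_l`
of the label of `v`. -/
noncomputable def deepest (v : V) : V :=
  match _h : T.lastChild v with
  | none => v
  | some w => deepest w
termination_by Fintype.card V - T.graph.dist T.root v
decreasing_by exact T.measure_lt (T.lastChild_mem _h)

theorem deepest_of_children_eq_nil {v : V} (h : T.children v = []) : T.deepest v = v := by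
  rw [deepest]
  split
  · rfl
  · rename_i hw
    rw [T.lastChild_eq_none.2 h] at hw
    cases hw

theorem deepest_of_lastChild {v w : V} (h : T.lastChild v = some w) :
    T.deepest v = T.deepest w := by
  rw [deepest]
  split <;> rename_i hw <;> rw [h] at hw <;> cases hw
  rfl

theorem deepest_mem_descendants (v : V) : T.deepest v ∈ T.descendants v := by
  induction v using T.child_induction with
  | _ v ih =>
    by_cases h : T.children v = []
    · exact (T.deepest_of_children_eq_nil h).symm ▸ T.mem_descendants_self v
    · obtain ⟨w, hw⟩ := T.exists_lastChild h
      have hwv := T.lastChild_mem hw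
      exact T.deepest_of_lastChild hw ▸ T.mem_descendants_of_child hwv (ih w hwv)

theorem depth_deepest (v : V) : T.depth (T.deepest v) = T.maxDepth v := by
  induction v using T.child_induction with
  | _ v ih =>
    by_cases h : T.children v = []
    · rw [T.deepest_of_children_eq_nil h, T.maxDepth_of_children_eq_nil h]
    · obtain ⟨w, hw⟩ := T.exists_lastChild h
      rw [T.deepest_of_lastChild hw, T.maxDepth_of_lastChild hw, ih w (T.lastChild_mem hw)]

variable (q : ℝ)

/-- The way from the deepest vertex of the subtree of `u` back to the parent of `u` is not longer
than the way from the root to that parent together with the invoking cost `q`, so that it does not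
pay to replace a returning agent by a new one. -/
def Near (u : V) : Prop := T.maxDepth u ≤ 2 * T.depth (T.parent u) + q

noncomputable instance (u : V) : Decidable (T.Near q u) :=
  inferInstanceAs (Decidable (T.maxDepth u ≤ 2 * T.depth (T.parent u) + q))

theorem near_iff {v u : V} (hu : u ∈ T.children v) :
    T.Near q u ↔ T.maxDepth u ≤ 2 * T.depth v + q := by
  rw [Near, T.parent_of_mem_children hu]

/-- The number of agents that explore the subtree of `v`: the entry `k` of the label of `v`. -/
noncomputable def agents (v : V) : ℕ :=
  max 1 ((T.children v).attach.map fun u => if T.Near q u.1 then 0 else agents u.1).sum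
termination_by Fintype.card V - T.graph.dist T.root v
decreasing_by exact T.measure_lt u.2

/-- The number of agents that do not leave the subtree of `u` again if `u` is not the last child of
its parent. -/
noncomputable def staying (u : V) : ℕ := if T.Near q u then 0 else T.agents q u

variable {q}

theorem agents_eq (v : V) :
    T.agents q v = max 1 ((T.children v).map (T.staying q)).sum := by
  rw [agents, ← List.attach_map_val (f := T.staying q)]
  rfl

theorem agents_of_children_eq_nil {v : V} (h : T.children v = []) : T.agents q v = 1 := by
  rw [agents_eq, h]
  rfl

theorem one_le_agents (v : V) : 1 ≤ T.agents q v := by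
  rw [agents_eq]
  exact le_max_left _ _

theorem near_of_maxDepth_le {v u : V} (h : T.maxDepth v ≤ 2 * T.depth v + q)
    (hu : u ∈ T.children v) : T.Near q u :=
  (T.near_iff q hu).2 ((T.maxDepth_le_of_mem_children hu).trans h)

theorem agents_of_maxDepth_le {v : V} (h : T.maxDepth v ≤ 2 * T.depth v + q) :
    T.agents q v = 1 := by
  rw [agents_eq, List.sum_eq_zero, max_eq_left zero_le_one]
  intro n hn
  obtain ⟨u, hu, rfl⟩ := List.mem_map.1 hn
  exact if_pos (T.near_of_maxDepth_le h hu)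

theorem Near.maxDepth_le {T : WeightedTree V} {u : V} (h : T.Near q u) :
    T.maxDepth u ≤ 2 * T.depth u + q := by
  have hpos := T.parentWeight_nonneg u
  rw [parentWeight] at hpos
  rw [Near] at h
  linarith

theorem Near.agents_eq_one {T : WeightedTree V} {u : V} (h : T.Near q u) : T.agents q u = 1 :=
  T.agents_of_maxDepth_le h.maxDepth_le

theorem agents_le_staying_add_one (u : V) : T.agents q u ≤ T.staying q u + 1 := by
  by_cases h : T.Near q u
  · rw [h.agents_eq_one]
    exact Nat.le_add_left ..
  · rw [staying, if_neg h]
    exact Nat.le_succ _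

theorem agents_of_lastChild [DecidableEq V] {v w : V} (h : T.lastChild v = some w) :
    T.agents q v = (((T.children v).erase w).map (T.staying q)).sum + T.agents q w := by
  have hw := T.lastChild_mem h
  rw [agents_eq, ← List.sum_map_erase (T.staying q) hw]
  by_cases hnear : T.Near q w
  · have hv : T.maxDepth v ≤ 2 * T.depth v + q :=
      T.maxDepth_of_lastChild h ▸ (T.near_iff q hw).1 hnear
    have hzero : (((T.children v).erase w).map (T.staying q)).sum = 0 := by
      refine List.sum_eq_zero fun n hn => ?_
      obtain ⟨u, hu, rfl⟩ := List.mem_map.1 hn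
      exact if_pos (T.near_of_maxDepth_le hv (List.mem_of_mem_erase hu))
    rw [hzero, staying, if_pos hnear, hnear.agents_eq_one]
    rfl
  · have hone := T.one_le_agents (q := q) w
    rw [staying, if_neg hnear, add_comm, max_eq_right (by omega)]

variable (q)

/-- The label that `setLabeling` computes for `v`. -/
noncomputable def label (v : V) : Label V := ⟨T.agents q v, T.deepest v, T.lastChild v⟩

variable {q}

theorem label_of_children_eq_nil {v : V} (h : T.children v = []) :
    T.label q v = ⟨1, v, none⟩ := by
  rw [label, T.agents_of_children_eq_nil h, T.deepest_of_children_eq_nil h,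
    T.lastChild_eq_none.2 h]

theorem label_of_lastChild {v w : V} (h : T.lastChild v = some w) :
    T.label q v = ⟨max 1 ((T.children v).map (T.staying q)).sum, T.deepest w, some w⟩ := by
  rw [label, agents_eq, T.deepest_of_lastChild h, h]

theorem val_labelBody {Λ : V → Label V} {v u : V} (hu : u ∈ T.children v)
    (hΛ : Λ u = T.label q u) (s : ℕ × ℝ × Option V) :
    (labelBody q T.depth Λ v u s).val = (s.1 + T.staying q u,
      if s.2.1 < T.maxDepth u - T.depth v then (T.maxDepth u - T.depth v, some u) else s.2) := by
  have hnear : T.maxDepth u - T.depth v ≤ T.depth v + q ↔ T.Near q u := by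
    rw [T.near_iff q hu, sub_le_iff_le_add]
    ring_nf
  have hk : (if decide (T.agents q u = 1) && decide (T.maxDepth u - T.depth v ≤ T.depth v + q)
      then s.1 + T.agents q u - 1 else s.1 + T.agents q u) = s.1 + T.staying q u := by
    simp only [hnear, staying, Bool.and_eq_true, decide_eq_true_eq]
    by_cases h : T.Near q u
    · simp [h, h.agents_eq_one]
    · simp [h]
  simp only [labelBody, Timed.val_op_bind, hΛ, label, depth_deepest, hk]
  by_cases h : s.2.1 < T.maxDepth u - T.depth v <;> simp [h]

theorem foldl_labelBody {Λ : V → Label V} {v : V}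
    (hΛ : ∀ u ∈ T.children v, Λ u = T.label q u) :
    (T.children v).foldl (fun s u => (labelBody q T.depth Λ v u s).val) (0, 0, none) =
      (((T.children v).map (T.staying q)).sum,
        (T.lastChild v).elim 0 (fun w => T.maxDepth w - T.depth v), T.lastChild v) := by
  have hprefix (l : List V) (hl : l ⊆ T.children v) :
      l.foldl (fun s u => (labelBody q T.depth Λ v u s).val) (0, 0, none) =
        ((l.map (T.staying q)).sum,
          (l.argmax T.maxDepth).elim 0 (fun w => T.maxDepth w - T.depth v),
          l.argmax T.maxDepth) := by
    induction l using List.reverseRecOn with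
    | nil => simp
    | append_singleton l u ih =>
      obtain ⟨hl, hu⟩ := List.append_subset.1 hl
      replace hu := hu List.mem_cons_self
      have hpos : T.depth v < T.maxDepth u :=
        (T.depth_lt_of_mem_children hu).trans_le (T.depth_le_maxDepth (T.mem_descendants_self u))
      rw [List.foldl_concat, ih hl, T.val_labelBody hu (hΛ u hu), List.argmax_concat]
      cases l.argmax T.maxDepth with
      | none => simp [hpos]
      | some w => by_cases h : T.maxDepth w < T.maxDepth u <;> simp [h]
  exact hprefix _ (List.Subset.refl _)

end Labels

/-! ## The computed tables -/

section Tables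

variable {V : Type} (T : WeightedTree V) [Fintype V] [DecidableEq V]

/-- The array `g` with the entries for the subtree of `v` overwritten by those of `f`. -/
def fillSubtree {α : Type*} (f : V → α) (v : V) (g : V → α) : V → α :=
  fun x => if x ∈ T.descendants v then f x else g x

variable {α : Type*}

theorem fillSubtree_self (f : V → α) (v : V) (g : V → α) : T.fillSubtree f v g v = f v :=
  if_pos (T.mem_descendants_self v)

theorem fillSubtree_root (f g : V → α) : T.fillSubtree f T.root g = f :=
  funext fun x => if_pos (T.mem_descendants_root x)

theorem fillSubtree_update (f : V → α) (v : V) (g : V → α) (a : α) :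
    T.fillSubtree f v (Function.update g v a) = T.fillSubtree f v g := by
  funext x
  by_cases hx : x = v
  · rw [hx, fillSubtree_self, fillSubtree_self]
  · simp only [fillSubtree, Function.update_of_ne hx]

theorem foldl_fillSubtree {f g : V → α} {v : V} {step : (V → α) → V → V → α}
    (hstep : ∀ u ∈ T.children v, ∀ g', g' v = g v → step g' u = T.fillSubtree f u g') :
    (T.children v).foldl step g = Function.update (T.fillSubtree f v g) v (g v) := by
  have hprefix (l : List V) (hl : l ⊆ T.children v) :
      l.foldl step g = fun x => if ∃ u ∈ l, x ∈ T.descendants u then f x else g x := by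
    induction l using List.reverseRecOn with
    | nil => simp
    | append_singleton l u ih =>
      obtain ⟨hl, hu⟩ := List.append_subset.1 hl
      have hv : ¬ ∃ u ∈ l, v ∈ T.descendants u := fun ⟨u, hu, hv⟩ =>
        T.notMem_descendants_child (hl hu) hv
      rw [List.foldl_concat, ih hl, hstep u (hu List.mem_cons_self) _ (if_neg hv)]
      funext x
      simp only [fillSubtree, List.mem_append, List.mem_singleton, or_and_right, exists_or,
        exists_eq_left]
      by_cases hxu : x ∈ T.descendants u <;> simp [hxu]
  rw [hprefix _ (List.Subset.refl _)]
  funext x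
  by_cases hx : x = v
  · subst hx
    rw [Function.update_self]
    exact if_neg fun ⟨u, hu, hv⟩ => T.notMem_descendants_child hu hv
  · simp only [Function.update_of_ne hx, fillSubtree, T.mem_descendants (v := v), hx, false_or]

theorem val_setDistances {v : V} {D : V → ℝ} (hD : D v = T.depth v) :
    (T.setDistances v D).val = T.fillSubtree T.depth v D := by
  induction v using T.child_induction generalizing D with
  | _ v ih =>
    rw [setDistances_eq, Timed.val_forEach, T.foldl_fillSubtree (f := T.depth), hD,
      ← T.fillSubtree_self T.depth v D, Function.update_eq_self]
    intro u hu D' hD'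
    simp only [Timed.val_op_bind]
    rw [hD', hD, ← T.depth_of_mem_children hu, ih u hu (Function.update_self ..),
      fillSubtree_update]

theorem val_setLabeling (q : ℝ) (v : V) (Λ : V → Label V) :
    (T.setLabeling q T.depth v Λ).val = T.fillSubtree (T.label q) v Λ := by
  induction v using T.child_induction generalizing Λ with
  | _ v ih =>
    have hself : T.fillSubtree (T.label q) v Λ =
        Function.update (T.fillSubtree (T.label q) v Λ) v (T.label q v) := by
      rw [← T.fillSubtree_self (T.label q) v Λ, Function.update_eq_self]
    have hloop : (T.children v).foldl (fun Λ u => (T.setLabeling q T.depth u Λ).val) Λ =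
        Function.update (T.fillSubtree (T.label q) v Λ) v (Λ v) :=
      T.foldl_fillSubtree fun u hu Λ' _ => ih u hu Λ'
    have hstore (a : Label V) :
        Function.update (Function.update (T.fillSubtree (T.label q) v Λ) v (Λ v)) v a =
          Function.update (T.fillSubtree (T.label q) v Λ) v a := Function.update_idem ..
    rw [hself]
    by_cases h : T.children v = []
    · rw [h, List.foldl_nil] at hloop
      rw [T.setLabeling_leaf q _ Λ h, Timed.val_op_bind, Timed.val_op,
        T.label_of_children_eq_nil h, ← hstore, ← hloop]
    · obtain ⟨w, hw⟩ := T.exists_lastChild h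
      rw [← hstore, T.label_of_lastChild hw, T.setLabeling_node q _ Λ h]
      simp only [Timed.val_bind, Timed.val_forEach]
      rw [hloop]
      set Λ' := Function.update (T.fillSubtree (T.label q) v Λ) v (Λ v) with hΛ'
      have hchild (u : V) (hu : u ∈ T.children v) : Λ' u = T.label q u := by
        rw [hΛ', Function.update_of_ne (T.ne_of_mem_children hu)]
        exact if_pos (T.mem_descendants_of_child hu (T.mem_descendants_self u))
      rw [T.foldl_labelBody hchild, hw]
      simp only [storeLabel, Timed.val_op_bind, Timed.val_op, hchild w (T.lastChild_mem hw), label]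

end Tables

/-! ## The computed instructions -/

theorem flatMap_ite_append_flatMap_ite {α β : Type*} [DecidableEq α] {l : List α} (hl : l.Nodup)
    {a : α} (ha : a ∈ l) (f g : α → List β) :
    (l.flatMap fun b => if a = b then [] else f b) ++
        (l.flatMap fun b => if a = b then g b else []) = (l.erase a).flatMap f ++ g a := by
  obtain ⟨l₁, l₂, rfl⟩ := List.append_of_mem ha
  rw [List.nodup_middle, List.nodup_cons, List.mem_append, not_or] at hl
  obtain ⟨⟨h₁, h₂⟩, -⟩ := hl
  have hf {l : List α} (h : a ∉ l) : (l.flatMap fun b => if a = b then [] else f b) = l.flatMap f :=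
    List.flatMap_congr fun b hb => if_neg (ne_of_mem_of_not_mem hb h).symm
  have hg {l : List α} (h : a ∉ l) : (l.flatMap fun b => if a = b then g b else []) = [] :=
    List.flatMap_eq_nil_iff.2 fun b hb => if_neg (ne_of_mem_of_not_mem hb h).symm
  simp only [List.erase_append_right _ h₁, List.erase_cons_head, List.flatMap_append,
    List.flatMap_cons, hf h₁, hf h₂, hg h₁, hg h₂, if_true, List.nil_append, List.append_nil]

section Program

variable {V : Type} (T : WeightedTree V) [Fintype V] [DecidableEq V] (q : ℝ)

/-- The instructions for the exploration of the subtree of `v` by the agents standing at `v`. -/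
noncomputable def explore (v : V) : List (Instr V) :=
  match _h : T.lastChild v with
  | none => []
  | some w =>
    (((T.children v).erase w).attach.flatMap fun u =>
      Instr.traverse v u.1 (T.agents q u.1) :: explore u.1 ++
        if T.Near q u.1 then [Instr.sendBack (T.deepest u.1) v] else []) ++
    Instr.traverse v w (T.agents q w) :: explore w
termination_by Fintype.card V - T.graph.dist T.root v
decreasing_by
  · exact T.measure_lt (List.mem_of_mem_erase u.2)
  · exact T.measure_lt (T.lastChild_mem _h)

/-- The instructions for the exploration of the subtree of the child `u` of `v` by agents standing
at `v`. -/
noncomputable def enter (v u : V) : List (Instr V) :=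
  Instr.traverse v u (T.agents q u) :: T.explore q u

/-- The instructions for a child `u` of `v` that is not the last one: the agent that has explored
the subtree of `u` returns to `v` if this pays off. -/
noncomputable def visit (v u : V) : List (Instr V) :=
  T.enter q v u ++ if T.Near q u then [Instr.sendBack (T.deepest u) v] else []

theorem explore_of_children_eq_nil {v : V} (h : T.children v = []) : T.explore q v = [] := by
  rw [explore]
  split
  · rfl
  · rename_i hw
    rw [T.lastChild_eq_none.2 h] at hw
    cases hw

theorem explore_of_lastChild {v w : V} (h : T.lastChild v = some w) :
    T.explore q v = ((T.children v).erase w).flatMap (T.visit q v) ++ T.enter q v w := by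
  rw [explore]
  split <;> rename_i hw <;> rw [h] at hw <;> cases hw
  simp only [List.flatMap_subtype, List.unattach_attach]
  rfl

theorem val_strategyBody {v u : V} (hu : u ∈ T.children v)
    (hrec : ∀ S, (T.setStrategy q T.depth (T.label q) u S).val = S ++ T.explore q u) (b : Bool)
    (S : List (Instr V)) :
    (T.strategyBody q T.depth (T.label q) v b u S).val = S ++
      if T.lastChild v = some u then (if b then T.enter q v u else [])
      else (if b then [] else T.visit q v u) := by
  have hnear : T.depth (T.deepest u) ≤ T.depth v + q + T.depth v ↔ T.Near q u := by
    rw [T.near_iff q hu, depth_deepest]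
    ring_nf
  by_cases hlast : T.lastChild v = some u <;> cases b <;> by_cases h : T.Near q u <;>
    simp [strategyBody, label, hnear, hlast, h, hrec, enter, visit]

theorem val_setStrategy (v : V) (S : List (Instr V)) :
    (T.setStrategy q T.depth (T.label q) v S).val = S ++
      (if v = T.root ∧ T.children v ≠ [] then [Instr.invoke (T.agents q v)] else []) ++
      T.explore q v := by
  induction v using T.child_induction generalizing S with
  | _ v ih =>
    by_cases h : T.children v = []
    · rw [T.setStrategy_leaf q _ _ _ h, T.explore_of_children_eq_nil q h]
      simp [h]
    obtain ⟨w, hw⟩ := T.exists_lastChild h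
    have hpass (b : Bool) (S : List (Instr V)) :
        (T.children v).foldl (fun S u => (T.strategyBody q T.depth (T.label q) v b u S).val) S =
          S ++ (T.children v).flatMap fun u => if w = u then (if b then T.enter q v u else [])
            else (if b then [] else T.visit q v u) := by
      rw [List.flatMap, ← List.foldl_append_eq_append]
      refine List.foldl_ext _ _ _ fun S u hu => ?_
      rw [T.val_strategyBody q hu (fun S => ?_) b S, hw]
      · simp only [Option.some.injEq]
      · rw [ih u hu, if_neg fun hroot => T.ne_root_of_mem_children hu hroot.1, List.append_nil]
    have hinvoke : (if v = T.root then Timed.op (S ++ [Instr.invoke (T.agents q v)])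
          else pure S : Timed _).val =
        S ++ if v = T.root ∧ T.children v ≠ [] then [Instr.invoke (T.agents q v)] else [] := by
      split <;> simp_all
    rw [T.setStrategy_node q _ _ _ h, T.explore_of_lastChild q hw,
      ← flatMap_ite_append_flatMap_ite (T.children_nodup v) (T.lastChild_mem hw), ← hinvoke]
    simp only [Timed.val_bind, Timed.val_forEach, List.foldl_cons, List.foldl_nil,
      hpass, label, List.append_assoc, if_true, Bool.false_eq_true, if_false]

theorem val_costExpl [Nontrivial V] :
    (T.costExpl q).val = Instr.invoke (T.agents q T.root) :: T.explore q T.root := by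
  simp only [costExpl, Timed.val_bind, Timed.alloc]
  rw [T.val_setDistances T.depth_root.symm, fillSubtree_root, val_setLabeling, fillSubtree_root,
    val_setStrategy, if_pos ⟨rfl, T.children_root_ne_nil⟩]
  rfl

end Program

/-! ## The costs of the branches -/

section Costs

variable {V : Type} (T : WeightedTree V) [Fintype V]

/-- The weight of the branch at `v`: the subtree of `v` and the edge from `v` to its parent. -/
noncomputable def branchWeight (v : V) : ℝ := T.subtreeSum T.parentWeight v

theorem branchWeight_eq (v : V) :
    T.branchWeight v = T.parentWeight v + ((T.children v).map T.branchWeight).sum :=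
  T.subtreeSum_eq T.parentWeight v

variable (q : ℝ)

/-- The cost of exploring the subtree of `v` by agents invoked for this purpose, including their
invocation and their way to `v`. The branch at a child is explored either by an agent that returns
from it, or by agents of its own. The last summand is what the agent that makes the round trips
pays for its invocation and its way to `v`, less the way back from a deepest vertex, which it saves;
if this is negative, then the branch of the deepest vertex has agents of its own, one of which
can make the round trips beforehand. -/
noncomputable def serve (v : V) : ℝ :=
  ((T.children v).attach.map fun u => min (2 * T.branchWeight u.1) (serve u.1)).sum +
    max 0 (2 * T.depth v + q - T.maxDepth v)
termination_by Fintype.card V - T.graph.dist T.root v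
decreasing_by exact T.measure_lt u.2

/-- The cost that the branch at `v` causes if its parent is visited anyway: either an agent goes
around the branch and returns, or the subtree of `v` is explored by agents of its own. -/
noncomputable def detour (v : V) : ℝ := min (2 * T.branchWeight v) (T.serve q v)

theorem serve_eq (v : V) :
    T.serve q v = ((T.children v).map (T.detour q)).sum +
      max 0 (2 * T.depth v + q - T.maxDepth v) := by
  rw [serve, ← List.attach_map_val (f := T.detour q)]
  rfl

theorem serve_of_maxDepth_le {v : V} (h : T.maxDepth v ≤ 2 * T.depth v + q) :
    T.serve q v = 2 * (T.branchWeight v - T.parentWeight v) +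
      (2 * T.depth v + q - T.maxDepth v) := by
  induction v using T.child_induction with
  | _ v ih =>
    have hdetour (u : V) (hu : u ∈ T.children v) : T.detour q u = 2 * T.branchWeight u := by
      have hnear := T.near_of_maxDepth_le h hu
      rw [detour, ih u hu hnear.maxDepth_le, min_eq_left]
      rw [Near] at hnear
      rw [parentWeight]
      linarith
    rw [serve_eq, List.map_congr_left hdetour, List.sum_map_mul_left, branchWeight_eq,
      max_eq_right (sub_nonneg.2 h), add_sub_cancel_left]

theorem serve_le_of_not_near {u : V} (h : ¬ T.Near q u) : T.serve q u ≤ 2 * T.branchWeight u := by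
  have hsum : ((T.children u).map (T.detour q)).sum ≤
      2 * ((T.children u).map T.branchWeight).sum := by
    rw [← List.sum_map_mul_left]
    exact List.sum_le_sum fun x _ => min_le_left _ _
  have hmax : max 0 (2 * T.depth u + q - T.maxDepth u) ≤ 2 * T.parentWeight u := by
    refine max_le (mul_nonneg zero_le_two (T.parentWeight_nonneg u)) ?_
    rw [Near] at h
    rw [parentWeight]
    linarith
  rw [serve_eq, branchWeight_eq]
  linarith

theorem serve_eq_detour_add (u : V) :
    T.serve q u = T.detour q u + max 0 (2 * T.depth (T.parent u) + q - T.maxDepth u) := by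
  by_cases h : T.Near q u
  · have hserve := T.serve_of_maxDepth_le q h.maxDepth_le
    rw [parentWeight] at hserve
    rw [Near] at h
    rw [detour, max_eq_right (by linarith), min_eq_left (by linarith)]
    linarith
  · rw [detour, min_eq_right (T.serve_le_of_not_near q h), max_eq_left, add_zero]
    rw [Near] at h
    linarith

theorem serve_of_children_eq_nil {v : V} (hq : 0 ≤ q) (h : T.children v = []) :
    T.serve q v = T.depth v + q := by
  have hv := T.depth_nonneg v
  rw [serve_eq, h, T.maxDepth_of_children_eq_nil h, List.map_nil, List.sum_nil, zero_add,
    max_eq_right (by linarith)]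
  ring

theorem serve_of_lastChild [DecidableEq V] {v w : V} (h : T.lastChild v = some w) :
    T.serve q v = (((T.children v).erase w).map (T.detour q)).sum + T.serve q w := by
  have hw := T.lastChild_mem h
  rw [serve_eq, ← List.sum_map_erase (T.detour q) hw, T.maxDepth_of_lastChild h,
    T.serve_eq_detour_add q w, T.parent_of_mem_children hw]
  ring

variable {v : V} {f : V → ℝ}

theorem serve_le_sum_map (hf : ∀ u ∈ T.children v, T.detour q u ≤ f u)
    (hserve : ∃ u ∈ T.children v, T.serve q u ≤ f u) :
    T.serve q v ≤ ((T.children v).map f).sum := by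
  classical
  obtain ⟨u, hu, hfu⟩ := hserve
  have hrest := List.sum_le_sum fun x (hx : x ∈ (T.children v).erase u) =>
    hf x (List.mem_of_mem_erase hx)
  have hmax : max 0 (2 * T.depth v + q - T.maxDepth v) ≤
      max 0 (2 * T.depth v + q - T.maxDepth u) := by
    gcongr
    exact T.maxDepth_le_of_mem_children hu
  rw [serve_eq_detour_add, T.parent_of_mem_children hu] at hfu
  rw [serve_eq, ← List.sum_map_erase (T.detour q) hu, ← List.sum_map_erase f hu]
  linarith

theorem serve_le_sum_map_add (hq : 0 ≤ q) (hf : ∀ u ∈ T.children v, T.detour q u ≤ f u) :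
    T.serve q v ≤ ((T.children v).map f).sum + (T.depth v + q) := by
  have hv := T.depth_nonneg v
  have hmaxDepth := T.depth_le_maxDepth (T.mem_descendants_self v)
  rw [serve_eq]
  exact add_le_add (List.sum_le_sum hf) (max_le (by linarith) (by linarith))

end Costs

/-! ## Moves described by instructions -/

section Moves

variable {V : Type} (T : WeightedTree V)

/-- The distance travelled in one move. -/
def moveWeight : Move V → ℝ
  | .invoke => 0
  | .traverse _ u v => T.weight s(u, v)

/-- The total distance travelled in a sequence of moves. -/
def travel (S : List (Move V)) : ℝ := (S.map T.moveWeight).sum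

theorem travel_append (S S' : List (Move V)) :
    T.travel (S ++ S') = T.travel S + T.travel S' := by
  rw [travel, List.map_append, List.sum_append, travel, travel]

theorem numAgents_append (S S' : List (Move V)) :
    numAgents (S ++ S') = numAgents S + numAgents S' := by
  rw [numAgents, List.map_append, List.sum_append, numAgents, numAgents]

theorem legalFrom_append (pos : List V) (S S' : List (Move V)) :
    T.LegalFrom pos (S ++ S') ↔ T.LegalFrom pos S ∧ T.LegalFrom (S.foldl T.after pos) S' := by
  induction S generalizing pos with
  | nil => simp [LegalFrom]
  | cons m S ih => simp [LegalFrom, ih, and_assoc]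

theorem expands_append (pos : List V) (L L' : List (Instr V)) (S : List (Move V)) :
    T.Expands pos (L ++ L') S ↔ ∃ S₁ S₂, S = S₁ ++ S₂ ∧ T.Expands pos L S₁ ∧
      T.Expands (S₁.foldl T.after pos) L' S₂ := by
  induction L generalizing pos S with
  | nil => simp [Expands]
  | cons I L ih =>
    simp only [List.cons_append, Expands, ih]
    constructor
    · rintro ⟨S₁, _, rfl, h₁, S₂, S₃, rfl, h₂, h₃⟩
      exact ⟨S₁ ++ S₂, S₃, by simp, ⟨S₁, S₂, rfl, h₁, h₂⟩, by simpa using h₃⟩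
    · rintro ⟨_, S₃, rfl, ⟨S₁, S₂, rfl, h₁, h₂⟩, h₃⟩
      exact ⟨S₁, S₂ ++ S₃, by simp, h₁, S₂, S₃, rfl, h₂, by simpa using h₃⟩

theorem expands_singleton {pos : List V} {I : Instr V} {S : List (Move V)} :
    T.Expands pos [I] S ↔ T.ExpandsInstr pos I S := by
  simp [Expands]

/-- The instructions can be carried out from the positions `pos`, and every sequence of moves that
they describe satisfies `Q`. -/
def Ensures (pos : List V) (L : List (Instr V)) (Q : List (Move V) → Prop) : Prop :=
  (∃ S, T.Expands pos L S) ∧ ∀ S, T.Expands pos L S → Q S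

/-- The vertex `x` is occupied at the beginning, with the agents in the positions `pos`, or it is
reached by one of the moves. -/
def Visited (pos : List V) (S : List (Move V)) (x : V) : Prop :=
  x ∈ pos ∨ ∃ m ∈ S, T.reached m = x

variable {T}

theorem Ensures.mono {pos : List V} {L : List (Instr V)} {Q Q' : List (Move V) → Prop}
    (h : T.Ensures pos L Q) (hQ : ∀ S, Q S → Q' S) : T.Ensures pos L Q' :=
  ⟨h.1, fun S hS => hQ S (h.2 S hS)⟩

theorem Ensures.nil {pos : List V} {Q : List (Move V) → Prop} (h : Q []) : T.Ensures pos [] Q :=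
  ⟨⟨[], rfl⟩, fun _ hS => hS ▸ h⟩

theorem Ensures.append {pos : List V} {L L' : List (Instr V)} {Q Q' : List (Move V) → Prop}
    (h : T.Ensures pos L Q)
    (h' : ∀ S, Q S → T.Ensures (S.foldl T.after pos) L' fun S' => Q' (S ++ S')) :
    T.Ensures pos (L ++ L') Q' := by
  obtain ⟨⟨S, hS⟩, hQ⟩ := h
  obtain ⟨S', hS'⟩ := (h' S (hQ S hS)).1
  refine ⟨⟨S ++ S', (T.expands_append ..).2 ⟨S, S', rfl, hS, hS'⟩⟩, fun S₀ hS₀ => ?_⟩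
  obtain ⟨S₁, S₂, rfl, h₁, h₂⟩ := (T.expands_append ..).1 hS₀
  exact (h' S₁ (hQ S₁ h₁)).2 S₂ h₂

theorem visited_of_mem_foldl_after {pos : List V} {S : List (Move V)} {x : V}
    (h : x ∈ S.foldl T.after pos) : T.Visited pos S x := by
  induction S using List.reverseRecOn with
  | nil => exact .inl h
  | append_singleton S m ih =>
    have hlast : x ∈ S.foldl T.after pos ∨ x = T.reached m := by
      rw [List.foldl_concat] at h
      cases m with
      | invoke => simpa [after, reached] using h
      | traverse i u v => exact List.mem_or_eq_of_mem_set h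
    rcases hlast with h | rfl
    · exact (ih h).imp_right fun ⟨m', hm', hx⟩ => ⟨m', List.mem_append_left _ hm', hx⟩
    · exact .inr ⟨m, List.mem_append_right _ List.mem_cons_self, rfl⟩

theorem Visited.append_right {pos : List V} {S : List (Move V)} {x : V} (h : T.Visited pos S x)
    (S' : List (Move V)) : T.Visited pos (S ++ S') x :=
  h.imp_right fun ⟨m, hm, hx⟩ => ⟨m, List.mem_append_left _ hm, hx⟩

theorem Visited.append_left {pos : List V} {S S' : List (Move V)} {x : V}
    (h : T.Visited (S.foldl T.after pos) S' x) : T.Visited pos (S ++ S') x := by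
  rcases h with h | ⟨m, hm, hx⟩
  · exact (visited_of_mem_foldl_after h).append_right S'
  · exact .inr ⟨m, List.mem_append_right _ hm, hx⟩

theorem ensures_invoke (m : ℕ) :
    T.Ensures [] [Instr.invoke m] fun S => T.LegalFrom [] S ∧ numAgents S = m ∧ T.travel S = 0 ∧
      S.foldl T.after [] = List.replicate m T.root := by
  simp only [Ensures, expands_singleton]
  refine ⟨⟨_, rfl⟩, ?_⟩
  rintro S rfl
  refine ⟨?_, by simp [numAgents, Move.invocations], by simp [travel, moveWeight], ?_⟩
  · generalize ([] : List V) = pos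
    induction m generalizing pos with
    | zero => trivial
    | succ m ih => exact ⟨trivial, ih _⟩
  · induction m with
    | zero => rfl
    | succ m ih => rw [List.replicate_succ', List.replicate_succ', List.foldl_concat, ih]; rfl

end Moves

section Effects

variable {V : Type} [DecidableEq V]

/-- The moves `S` are legal from the positions `pos`, invoke no agents, travel the distance `t` and
visit every vertex of `U`. Outside `U` they take `out x` agents away from the vertex `x`; nothing is
said about the positions of agents in `U` at the end. -/
structure Effect (T : WeightedTree V) (U : Set V) (out : V → ℤ) (t : ℝ) (pos : List V)
    (S : List (Move V)) : Prop where
  legal : T.LegalFrom pos S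
  numAgents_eq : numAgents S = 0
  travel_eq : T.travel S = t
  visited : ∀ x ∈ U, T.Visited pos S x
  count_add : ∀ x ∉ U, ((S.foldl T.after pos).count x : ℤ) + out x = pos.count x

variable {T : WeightedTree V}

namespace Effect

theorem nil (pos : List V) : T.Effect ∅ 0 0 pos [] where
  legal := trivial
  numAgents_eq := rfl
  travel_eq := rfl
  visited _ hx := hx.elim
  count_add _ _ := add_zero _

theorem append {U U' : Set V} {out out' : V → ℤ} {t t' : ℝ} {pos : List V} {S S' : List (Move V)}
    (h : T.Effect U out t pos S) (h' : T.Effect U' out' t' (S.foldl T.after pos) S') :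
    T.Effect (U ∪ U') (out + out') (t + t') pos (S ++ S') where
  legal := (T.legalFrom_append ..).2 ⟨h.legal, h'.legal⟩
  numAgents_eq := by rw [numAgents_append, h.numAgents_eq, h'.numAgents_eq]
  travel_eq := by rw [travel_append, h.travel_eq, h'.travel_eq]
  visited x hx := hx.elim (fun hx => (h.visited x hx).append_right S')
    fun hx => (h'.visited x hx).append_left
  count_add x hx := by
    have hcount := h.count_add x fun hU => hx (.inl hU)
    have hcount' := h'.count_add x fun hU' => hx (.inr hU')
    rw [List.foldl_append, Pi.add_apply]
    omega

theorem mono {U U' : Set V} {out out' : V → ℤ} {t t' : ℝ} {pos : List V} {S : List (Move V)}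
    (h : T.Effect U out t pos S) (hU : U ⊆ U') (hvisited : ∀ x ∈ U', T.Visited pos S x)
    (hout : ∀ x ∉ U', out x = out' x) (ht : t = t') : T.Effect U' out' t' pos S where
  legal := h.legal
  numAgents_eq := h.numAgents_eq
  travel_eq := h.travel_eq.trans ht
  visited := hvisited
  count_add x hx := hout x hx ▸ h.count_add x fun hxU => hx (hU hxU)

theorem traverse {pos : List V} {i : ℕ} {u v : V} (hi : pos[i]? = some u)
    (huv : T.graph.Adj u v) :
    T.Effect ∅ (Pi.single u 1 - Pi.single v 1) (T.weight s(u, v)) pos [Move.traverse i u v] where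
  legal := ⟨⟨hi, huv⟩, trivial⟩
  numAgents_eq := rfl
  travel_eq := add_zero _
  visited _ hx := hx.elim
  count_add x _ := by
    obtain ⟨hlt, hu⟩ := List.getElem?_eq_some_iff.1 hi
    have hpos : 0 < pos.count u := List.count_pos_iff.2 (hu ▸ List.getElem_mem hlt)
    simp only [List.foldl_cons, List.foldl_nil, after, List.count_set hlt, hu, Pi.sub_apply,
      Pi.single_apply, beq_iff_eq, eq_comm (a := x)]
    by_cases hxu : u = x <;> by_cases hxv : v = x <;> simp only [hxu, hxv, if_true, if_false] <;>
      grind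

theorem traverse_agents {pos : List V} {A : List ℕ} {u v : V} (hA : A.Nodup)
    (hpos : ∀ i ∈ A, pos[i]? = some u) (huv : T.graph.Adj u v) :
    T.Effect ∅ ((A.length : ℤ) • (Pi.single u 1 - Pi.single v 1)) (A.length * T.weight s(u, v)) pos
      (A.map fun i => Move.traverse i u v) := by
  induction A generalizing pos with
  | nil => simpa using nil pos
  | cons i A ih =>
    obtain ⟨hi, hA⟩ := List.nodup_cons.1 hA
    have hfirst := traverse (hpos i List.mem_cons_self) huv
    have hrest := ih (pos := pos.set i v) hA fun j hj => by
      rw [List.getElem?_set_ne (ne_of_mem_of_not_mem hj hi).symm]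
      exact hpos j (List.mem_cons_of_mem _ hj)
    convert hfirst.append hrest using 1
    · simp
    · simp only [List.length_cons, Nat.cast_succ]
      module
    · push_cast [List.length_cons]
      ring
    · rfl

theorem traverse_walk {pos : List V} {i : ℕ} {x y : V} (p : T.graph.Walk x y)
    (hi : pos[i]? = some x) :
    T.Effect ∅ (Pi.single x 1 - Pi.single y 1) (T.walkWeight p) pos
      (p.darts.map fun d => Move.traverse i d.fst d.snd) := by
  induction p generalizing pos with
  | nil => simpa [walkWeight] using nil pos
  | cons h p ih =>
    have hlt := (List.getElem?_eq_some_iff.1 hi).1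
    convert (traverse hi h).append (ih (pos := pos.set i _) (List.getElem?_set_self hlt)) using 1
    · simp
    · simp
    · simp [walkWeight]
    · rfl

end Effect

theorem ensures_traverse {pos : List V} {u v : V} (huv : T.graph.Adj u v) {m : ℕ}
    (hm : m ≤ pos.count u) :
    T.Ensures pos [Instr.traverse u v m]
      (T.Effect ∅ ((m : ℤ) • (Pi.single u 1 - Pi.single v 1)) (m * T.weight s(u, v)) pos) := by
  simp only [Ensures, expands_singleton]
  refine ⟨⟨_, (pos.idxsOf u).take m, List.nodup_idxsOf.take, ?_, fun i hi => ?_, rfl⟩, ?_⟩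
  · rw [List.length_take, List.length_idxsOf, min_eq_left hm]
  · simpa [List.getElem?_eq_some_iff] using
      List.mem_idxsOf_iff_exists_getElem_pos.1 (List.mem_of_mem_take hi)
  · rintro S ⟨A, hA, rfl, hpos, rfl⟩
    exact .traverse_agents hA hpos huv

theorem ensures_sendBack [Fintype V] {pos : List V} {v x : V} (hx : x ∈ T.descendants v)
    (hpos : x ∈ pos) :
    T.Ensures pos [Instr.sendBack x v]
      (T.Effect {x} (Pi.single v (-1)) (T.depth x - T.depth v) pos) := by
  obtain ⟨p, hp, hdepth⟩ := T.exists_path_of_mem_descendants hx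
  simp only [Ensures, expands_singleton]
  constructor
  · obtain ⟨i, hi⟩ := List.mem_iff_getElem?.1 hpos
    exact ⟨_, i, p.reverse, hi, hp.reverse, rfl⟩
  · rintro S ⟨i, p', hi, hp', rfl⟩
    obtain rfl := (T.isTree.existsUnique_path x v).unique hp.reverse hp'
    refine (Effect.traverse_walk p.reverse hi).mono (Set.empty_subset _) ?_ (fun y hy => ?_) ?_
    · rintro y rfl
      exact .inl hpos
    · rw [Pi.sub_apply, Pi.single_eq_of_ne hy, zero_sub, Pi.single_neg, Pi.neg_apply]
    · rw [hdepth, add_sub_cancel_left, walkWeight, SimpleGraph.Walk.edges_reverse,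
        List.map_reverse, List.sum_reverse, walkWeight]

end Effects

/-! ## Carrying out the computed instructions -/

section Execution

variable {V : Type} [Fintype V] [DecidableEq V] {T : WeightedTree V} {q : ℝ} {pos : List V}

/-- The moves `S` visit the subtree of `u`, leave an agent at its deepest vertex, and have the other
effects that the remaining arguments describe. -/
def ExploresBelow (T : WeightedTree V) (u : V) (out : V → ℤ) (t : ℝ) (pos : List V)
    (S : List (Move V)) : Prop :=
  T.Effect {x | x ∈ T.descendants u} out t pos S ∧ T.deepest u ∈ S.foldl T.after pos

/-- Whenever enough agents stand at `v`, they can carry out the instructions `T.explore q v`, and in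
doing so they visit the subtree of `v` for the cost `T.serve q v`, less what has already been paid
for their invocation and their way to `v`. -/
def ExploreEnsured (T : WeightedTree V) (q : ℝ) (v : V) : Prop :=
  ∀ pos, T.agents q v ≤ pos.count v → T.Ensures pos (T.explore q v)
    (T.ExploresBelow v 0 (T.serve q v - T.agents q v * (T.depth v + q)) pos)

theorem ensures_enter {v u : V} (hu : u ∈ T.children v) (hpos : T.agents q u ≤ pos.count v)
    (hrec : T.ExploreEnsured q u) :
    T.Ensures pos (T.enter q v u) (T.ExploresBelow u (Pi.single v (T.agents q u : ℤ))
      (T.serve q u - T.agents q u * (T.depth v + q)) pos) := by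
  refine (ensures_traverse (T.adj_of_mem_children hu) hpos).append (L' := T.explore q u)
    fun S hS => (hrec _ ?_).mono fun S' ⟨hS', hdeepest⟩ => ⟨?_, ?_⟩
  · have hcount := hS.count_add u (Set.notMem_empty u)
    simp only [Pi.smul_apply, Pi.sub_apply, Pi.single_eq_same,
      Pi.single_eq_of_ne (T.ne_of_mem_children hu), smul_eq_mul] at hcount
    omega
  · have happend := hS.append hS'
    rw [Set.empty_union] at happend
    refine happend.mono subset_rfl happend.visited (fun x hx => ?_) ?_
    · have hxu : x ≠ u := fun h => hx (h ▸ T.mem_descendants_self u)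
      simp [Pi.single_apply, hxu]
    · rw [T.depth_of_mem_children hu]
      ring
  · rwa [List.foldl_append]

theorem ensures_visit {v u : V} (hu : u ∈ T.children v) (hpos : T.agents q u ≤ pos.count v)
    (hrec : T.ExploreEnsured q u) :
    T.Ensures pos (T.visit q v u) (T.Effect {x | x ∈ T.descendants u}
      (Pi.single v (T.staying q u : ℤ))
      (T.detour q u - T.staying q u * (T.depth v + q)) pos) := by
  have hserve := T.serve_eq_detour_add q u
  rw [T.parent_of_mem_children hu] at hserve
  refine (ensures_enter hu hpos hrec).append fun S ⟨hS, hdeepest⟩ => ?_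
  by_cases h : T.Near q u
  · rw [if_pos h, staying, if_pos h]
    rw [h.agents_eq_one] at hS
    rw [max_eq_right (by linarith [(T.near_iff q hu).1 h])] at hserve
    have hmem := T.deepest_mem_descendants u
    refine (ensures_sendBack (T.mem_descendants_of_child hu hmem) hdeepest).mono fun S' hS' => ?_
    have happend := hS.append hS'
    have hunion : {x | x ∈ T.descendants u} ∪ {T.deepest u} = {x | x ∈ T.descendants u} :=
      Set.union_eq_left.2 (Set.singleton_subset_iff.2 hmem)
    rw [hunion] at happend
    refine happend.mono subset_rfl happend.visited (fun x _ => ?_) ?_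
    · rw [← Pi.single_add]
      rfl
    · rw [depth_deepest]
      push_cast
      linarith
  · rw [if_neg h, staying, if_neg h]
    rw [max_eq_left (by linarith [lt_of_not_ge (mt (T.near_iff q hu).2 h)]), add_zero] at hserve
    rw [hserve] at hS
    exact .nil ((List.append_nil S).symm ▸ hS)

theorem ensures_flatMap_visit {v : V} {l : List V} (hl : l ⊆ T.children v)
    (hpos : (l.map (T.staying q)).sum + 1 ≤ pos.count v)
    (hrec : ∀ u ∈ l, T.ExploreEnsured q u) :
    T.Ensures pos (l.flatMap (T.visit q v)) (T.Effect {x | ∃ u ∈ l, x ∈ T.descendants u}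
      (Pi.single v ((l.map (T.staying q)).sum : ℤ))
      ((l.map (T.detour q)).sum - (l.map (T.staying q)).sum * (T.depth v + q)) pos) := by
  induction l generalizing pos with
  | nil => exact .nil (by simpa using Effect.nil pos)
  | cons u l ih =>
    obtain ⟨hu, hl⟩ := List.cons_subset.1 hl
    obtain ⟨hrecu, hrecl⟩ := List.forall_mem_cons.1 hrec
    rw [List.map_cons, List.sum_cons] at hpos
    have hagents := T.agents_le_staying_add_one (q := q) u
    rw [List.flatMap_cons]
    refine (ensures_visit hu (by omega) hrecu).append fun S hS => (ih hl ?_ hrecl).mono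
      fun S' hS' => ?_
    · have hcount := hS.count_add v (T.notMem_descendants_child hu)
      rw [Pi.single_eq_same] at hcount
      omega
    · convert hS.append hS' using 1
      · ext x
        simp
      · rw [← Pi.single_add]
        simp
      · simp only [List.map_cons, List.sum_cons, Nat.cast_add]
        ring

theorem exploreEnsured (hq : 0 ≤ q) (v : V) : T.ExploreEnsured q v := by
  induction v using T.child_induction with
  | _ v ih =>
    intro pos hpos
    have hv : v ∈ pos := List.count_pos_iff.1 ((T.one_le_agents v).trans hpos)
    by_cases h : T.children v = []
    · rw [T.explore_of_children_eq_nil q h, T.serve_of_children_eq_nil q hq h,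
        T.agents_of_children_eq_nil h]
      refine .nil ⟨(Effect.nil pos).mono (Set.empty_subset _) (fun x hx => .inl ?_)
        (fun _ _ => rfl) (by simp), (T.deepest_of_children_eq_nil h).symm ▸ hv⟩
      obtain rfl : x = v := by simpa [descendants_eq, h] using hx
      exact hv
    · obtain ⟨w, hlast⟩ := T.exists_lastChild h
      have hw := T.lastChild_mem hlast
      have hagents := T.agents_of_lastChild (q := q) hlast
      have hone := T.one_le_agents (q := q) w
      rw [T.explore_of_lastChild q hlast]
      refine (ensures_flatMap_visit (List.erase_subset) (by omega)
        fun u hu => ih u (List.mem_of_mem_erase hu)).append fun S hS =>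
        (ensures_enter hw ?_ (ih w hw)).mono fun S' ⟨hS', hdeepest⟩ => ⟨?_, ?_⟩
      · have hcount := hS.count_add v fun ⟨u, hu, hvu⟩ =>
          T.notMem_descendants_child (List.mem_of_mem_erase hu) hvu
        rw [Pi.single_eq_same] at hcount
        omega
      · have happend := hS.append hS'
        refine happend.mono ?_ (fun x hx => ?_) (fun x hx => ?_) ?_
        · rintro x (⟨u, hu, hx⟩ | hx)
          · exact T.mem_descendants_of_child (List.mem_of_mem_erase hu) hx
          · exact T.mem_descendants_of_child hw hx
        · rcases T.mem_descendants.1 hx with rfl | ⟨u, hu, hxu⟩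
          · exact .inl hv
          · by_cases huw : u = w
            · exact happend.visited x (.inr (huw ▸ hxu))
            · exact happend.visited x (.inl ⟨u, (List.mem_erase_of_ne huw).2 hu, hxu⟩)
        · have hxv : x ≠ v := fun h => hx (h ▸ T.mem_descendants_self v)
          simp [hxv]
        · rw [hagents, T.serve_of_lastChild q hlast]
          push_cast
          ring
      · rwa [List.foldl_append, T.deepest_of_lastChild hlast]

theorem ensures_costExpl [Nontrivial V] (hq : 0 ≤ q) :
    T.Ensures [] (T.costExpl q).val fun S =>
      T.IsStrategy S ∧ T.Explores S ∧ numAgents S * q + T.travel S = T.serve q T.root := by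
  rw [val_costExpl]
  refine (ensures_invoke (T.agents q T.root)).append (L' := T.explore q T.root)
    fun S ⟨hlegal, hagents, htravel, hpos⟩ =>
      (exploreEnsured hq T.root _ ?_).mono fun S' ⟨hS', _⟩ => ⟨?_, fun x => ?_, ?_⟩
  · rw [hpos, List.count_replicate_self]
  · exact (T.legalFrom_append ..).2 ⟨hlegal, hS'.legal⟩
  · exact (hS'.visited x (T.mem_descendants_root x)).append_left.resolve_left List.not_mem_nil
  · rw [numAgents_append, hagents, hS'.numAgents_eq, travel_append, htravel, hS'.travel_eq,
      depth_root]
    push_cast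
    ring

end Execution

/-! ## The cost as a sum over the edges -/

section Cost

variable {V : Type} {T : WeightedTree V}

theorem length_foldl_after (pos : List V) (S : List (Move V)) :
    (S.foldl T.after pos).length = pos.length + numAgents S := by
  induction S generalizing pos with
  | nil => rfl
  | cons m S ih =>
    rw [List.foldl_cons, ih]
    cases m <;> simp [after, numAgents, Move.invocations, add_assoc]

theorem lt_numAgents_of_mem {S : List (Move V)} (h : T.IsStrategy S) {i : ℕ} {u v : V}
    (hm : Move.traverse i u v ∈ S) : i < numAgents S := by
  obtain ⟨S₁, S₂, rfl⟩ := List.append_of_mem hm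
  have hi := ((T.legalFrom_append ..).1 h).2.1.1
  have hlt := (List.getElem?_eq_some_iff.1 hi).1
  rw [length_foldl_after, List.length_nil, zero_add] at hlt
  exact hlt.trans_le (numAgents_append S₁ _ ▸ Nat.le_add_right ..)

theorem numAgents_pos {S : List (Move V)} (h : T.IsStrategy S) (hS : T.Explores S) :
    0 < numAgents S := by
  obtain ⟨m, hm, -⟩ := hS T.root
  cases m with
  | invoke => exact List.sum_pos_iff_exists_pos_nat.2 ⟨1, List.mem_map_of_mem hm, one_pos⟩
  | traverse i u v => exact Nat.zero_lt_of_lt (lt_numAgents_of_mem h hm)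

theorem sum_moveLength {N : ℕ} {m : Move V} (h : ∀ i u v, m = Move.traverse i u v → i < N) :
    ∑ i ∈ Finset.range N, T.moveLength i m = T.moveWeight m := by
  cases m with
  | invoke => exact Finset.sum_const_zero
  | traverse i u v =>
    simp only [moveLength, moveWeight, Finset.sum_ite_eq, Finset.mem_range, h i u v rfl, if_true]

theorem sum_agentDistance {S : List (Move V)} {N : ℕ}
    (h : ∀ i u v, Move.traverse i u v ∈ S → i < N) :
    ∑ i ∈ Finset.range N, T.agentDistance S i = T.travel S := by
  induction S with
  | nil => exact Finset.sum_const_zero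
  | cons m S ih =>
    have hS := ih fun i u v hm => h i u v (List.mem_cons_of_mem _ hm)
    have hm : ∑ i ∈ Finset.range N, T.moveLength i m = T.moveWeight m :=
      sum_moveLength fun i u v hi => h i u v (hi ▸ List.mem_cons_self)
    simp only [agentDistance, travel, List.map_cons, List.sum_cons, Finset.sum_add_distrib, hm]
      at hS ⊢
    rw [hS]

theorem cost_eq (q : ℝ) {S : List (Move V)} (h : T.IsStrategy S) :
    T.cost q S = numAgents S * q + T.travel S := by
  rw [cost, sum_agentDistance fun i u v => lt_numAgents_of_mem h]

end Cost

section Crossings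

variable {V : Type} (T : WeightedTree V) [Fintype V] [DecidableEq V]

/-- The number of agents in the subtree of `c`. -/
def occupancy (c : V) (pos : List V) : ℕ := pos.countP (· ∈ T.descendants c)

/-- The number of times that the edge from `c` to its parent is traversed in a move. -/
def crossing (c : V) : Move V → ℕ
  | .invoke => 0
  | .traverse _ u v => if u ∈ T.descendants c ↔ v ∈ T.descendants c then 0 else 1

/-- The number of times that the edge from `c` to its parent is traversed. -/
def crossings (c : V) (S : List (Move V)) : ℕ := (S.map (T.crossing c)).sum

theorem occupancy_eq_subtreeSum (c : V) (pos : List V) :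
    T.occupancy c pos = T.subtreeSum (fun x => pos.count x) c := by
  rw [occupancy, subtreeSum, ← List.sum_toFinset _ (T.nodup_descendants c)]
  induction pos with
  | nil => simp
  | cons a pos ih =>
    simp [List.countP_cons, List.count_cons, Finset.sum_add_distrib, ih]

theorem sum_occupancy_children_le (v : V) (pos : List V) :
    ((T.children v).map fun u => T.occupancy u pos).sum ≤ T.occupancy v pos := by
  simp only [occupancy_eq_subtreeSum]
  rw [T.subtreeSum_eq _ v]
  exact Nat.le_add_left ..

theorem occupancy_root (pos : List V) : T.occupancy T.root pos = pos.length :=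
  List.countP_eq_length.2 fun x _ => decide_eq_true (T.mem_descendants_root x)

variable {T}

theorem occupancy_after {c : V} (hc : c ≠ T.root) {pos : List V} {m : Move V}
    (h : T.LegalMove pos m) :
    T.occupancy c (T.after pos m) = T.occupancy c pos + T.crossing c m ∨
      T.occupancy c (T.after pos m) + T.crossing c m = T.occupancy c pos := by
  cases m with
  | invoke => simp [occupancy, after, crossing, T.root_notMem_descendants hc]
  | traverse i u v =>
    obtain ⟨hlt, hi⟩ := List.getElem?_eq_some_iff.1 h.1
    have hpos : u ∈ T.descendants c → 0 < T.occupancy c pos := fun hu =>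
      List.countP_pos_iff.2 ⟨u, hi ▸ List.getElem_mem hlt, decide_eq_true hu⟩
    simp only [occupancy, after, crossing, List.countP_set hlt, hi] at hpos ⊢
    by_cases hu : u ∈ T.descendants c <;> by_cases hv : v ∈ T.descendants c <;>
      simp_all

theorem occupancy_foldl_after {c : V} (hc : c ≠ T.root) {pos : List V} {S : List (Move V)}
    (h : T.LegalFrom pos S) :
    T.occupancy c (S.foldl T.after pos) ≤ T.occupancy c pos + T.crossings c S ∧
      Even (T.occupancy c pos + T.occupancy c (S.foldl T.after pos) + T.crossings c S) := by
  induction S generalizing pos with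
  | nil => simp [crossings]
  | cons m S ih =>
    obtain ⟨hle, heven⟩ := ih h.2
    have hm := occupancy_after hc h.1
    simp only [crossings, List.map_cons, List.sum_cons, List.foldl_cons, Nat.even_iff]
      at hle heven ⊢
    omega

theorem one_le_crossings {S : List (Move V)} (h : T.IsStrategy S) (hS : T.Explores S) {c : V}
    (hc : c ≠ T.root) : 1 ≤ T.crossings c S := by
  obtain ⟨m, hm, rfl⟩ := hS c
  obtain ⟨S₁, S₂, rfl⟩ := List.append_of_mem hm
  rw [List.append_cons] at h ⊢
  have hlegal := ((T.legalFrom_append ..).1 h).1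
  have hocc : 0 < T.occupancy (T.reached m) ((S₁ ++ [m]).foldl T.after []) := by
    refine List.countP_pos_iff.2 ⟨T.reached m, ?_, decide_eq_true (T.mem_descendants_self _)⟩
    have hlast := ((T.legalFrom_append ..).1 hlegal).2.1
    rw [List.foldl_concat]
    cases m with
    | invoke => exact List.mem_concat_self
    | traverse i u v => exact List.mem_set (List.getElem?_eq_some_iff.1 hlast.1).1 _
  have hle := (occupancy_foldl_after hc hlegal).1
  have hnil : T.occupancy (T.reached m) [] = 0 := rfl
  rw [crossings, List.map_append, List.sum_append, ← crossings]
  omega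

/-- The least number of traversals of the edge above a subtree that is explored and in which `n`
agents end: if no agent stays there, then one has to return. -/
def leastCrossings (n : ℕ) : ℕ := if n = 0 then 2 else n

theorem leastCrossings_le {S : List (Move V)} (h : T.IsStrategy S) (hS : T.Explores S) {c : V}
    (hc : c ≠ T.root) :
    leastCrossings (T.occupancy c (S.foldl T.after [])) ≤ T.crossings c S := by
  obtain ⟨hle, heven⟩ := occupancy_foldl_after hc h
  have hone := one_le_crossings h hS hc
  have hnil : T.occupancy c [] = 0 := rfl
  rw [Nat.even_iff] at heven
  rw [leastCrossings]
  split <;> omega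

theorem crossing_of_mem_children {u v : V} (h : v ∈ T.children u) (i : ℕ) (c : V) :
    T.crossing c (Move.traverse i u v) = (if v = c then 1 else 0) ∧
      T.crossing c (Move.traverse i v u) = if v = c then 1 else 0 := by
  have hiff : (u ∈ T.descendants c ↔ v ∈ T.descendants c) ↔ v ≠ c := by
    rw [T.mem_descendants_of_mem_children_iff h]
    refine ⟨?_, fun hvc => by simp [hvc]⟩
    rintro huv rfl
    exact T.notMem_descendants_child h (huv.2 (.inr rfl))
  simp only [crossing, Iff.comm (a := v ∈ _), hiff, ite_not, and_self]

theorem sum_crossing {pos : List V} {m : Move V} (h : T.LegalMove pos m) :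
    ∑ c, T.parentWeight c * T.crossing c m = T.moveWeight m := by
  cases m with
  | invoke => simp [crossing, moveWeight]
  | traverse i u v =>
    rcases T.mem_children_or_mem_children_of_adj h.2 with hv | hu
    · simp [(crossing_of_mem_children hv i _).1, moveWeight, T.parentWeight_of_mem_children hv]
    · simp [(crossing_of_mem_children hu i _).2, moveWeight, T.parentWeight_of_mem_children hu,
        Sym2.eq_swap]

theorem travel_eq_sum {pos : List V} {S : List (Move V)} (h : T.LegalFrom pos S) :
    T.travel S = ∑ c, T.parentWeight c * T.crossings c S := by
  induction S generalizing pos with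
  | nil => simp [travel, crossings]
  | cons m S ih =>
    have hS := ih h.2
    simp only [travel, crossings, List.map_cons, List.sum_cons, Nat.cast_add, mul_add,
      Finset.sum_add_distrib] at hS ⊢
    rw [hS, sum_crossing h.1]

end Crossings

/-! ## The lower bound -/

section LowerBound

variable {V : Type} (T : WeightedTree V) [Fintype V] (n : V → ℕ)

/-- The least distance travelled in the branch at `v` if the subtree of `v` is explored and, for
every vertex `x` of it, `n x` agents end in the subtree of `x`. -/
noncomputable def leastTravel (v : V) : ℝ :=
  T.subtreeSum (fun x => T.parentWeight x * leastCrossings (n x)) v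

theorem leastTravel_eq (v : V) :
    T.leastTravel n v = T.parentWeight v * leastCrossings (n v) +
      ((T.children v).map (T.leastTravel n)).sum :=
  T.subtreeSum_eq _ v

variable {T n}

theorem leastTravel_of_eq_zero (hn : ∀ v, ((T.children v).map n).sum ≤ n v) {v : V}
    (h : n v = 0) : T.leastTravel n v = 2 * T.branchWeight v := by
  induction v using T.child_induction with
  | _ v ih =>
    have hchild : ∀ u ∈ T.children v, n u = 0 := fun u hu =>
      Nat.le_zero.1 (h ▸ (List.le_sum_of_mem (List.mem_map_of_mem hu)).trans (hn v))
    rw [leastTravel_eq, branchWeight_eq, List.map_congr_left fun u hu => ih u hu (hchild u hu),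
      List.sum_map_mul_left, h, leastCrossings, if_pos rfl]
    push_cast
    ring

theorem serve_le_mul_add_leastTravel {q : ℝ} (hq : 0 ≤ q)
    (hn : ∀ v, ((T.children v).map n).sum ≤ n v) {v : V} (h : n v ≠ 0) :
    T.serve q v ≤ n v * (T.depth (T.parent v) + q) + T.leastTravel n v := by
  induction v using T.child_induction with
  | _ v ih =>
    have hbudget : 0 ≤ T.depth v + q := add_nonneg (T.depth_nonneg v) hq
    have hserve {u : V} (hu : u ∈ T.children v) (hnu : n u ≠ 0) :
        T.serve q u ≤ n u * (T.depth v + q) + T.leastTravel n u :=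
      T.parent_of_mem_children hu ▸ ih u hu hnu
    have hdetour (u : V) (hu : u ∈ T.children v) :
        T.detour q u ≤ n u * (T.depth v + q) + T.leastTravel n u := by
      by_cases hnu : n u = 0
      · rw [hnu, Nat.cast_zero, zero_mul, zero_add, leastTravel_of_eq_zero hn hnu]
        exact min_le_left ..
      · exact (min_le_right ..).trans (hserve hu hnu)
    suffices hsum : T.serve q v ≤
        n v * (T.depth v + q) + ((T.children v).map (T.leastTravel n)).sum by
      rw [leastTravel_eq, leastCrossings, if_neg h, parentWeight]
      linarith
    have hflow : ((T.children v).map fun u => n u * (T.depth v + q) + T.leastTravel n u).sum =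
        ((T.children v).map n).sum * (T.depth v + q) +
          ((T.children v).map (T.leastTravel n)).sum := by
      rw [List.sum_map_add, List.sum_map_mul_right, Nat.cast_list_sum, List.map_map]
      rfl
    by_cases hex : ∃ u ∈ T.children v, n u ≠ 0
    · obtain ⟨u, hu, hnu⟩ := hex
      refine (T.serve_le_sum_map q hdetour ⟨u, hu, hserve hu hnu⟩).trans (hflow.trans_le ?_)
      gcongr
      exact hn v
    · push Not at hex
      have hzero : ((T.children v).map n).sum = 0 := by
        rw [List.map_congr_left hex, List.map_const', List.sum_replicate, smul_zero]
      rw [hzero, Nat.cast_zero, zero_mul, zero_add] at hflow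
      have hle := T.serve_le_sum_map_add q hq hdetour
      have hone : T.depth v + q ≤ n v * (T.depth v + q) :=
        le_mul_of_one_le_left hbudget (Nat.one_le_cast.2 (Nat.pos_of_ne_zero h))
      linarith

theorem serve_root_le_cost {q : ℝ} (hq : 0 ≤ q) {S : List (Move V)}
    (h : T.IsStrategy S) (hS : T.Explores S) : T.serve q T.root ≤ T.cost q S := by
  classical
  have hroot : T.occupancy T.root (S.foldl T.after []) = numAgents S := by
    rw [occupancy_root, length_foldl_after, List.length_nil, zero_add]
  have hserve := serve_le_mul_add_leastTravel (n := fun v => T.occupancy v (S.foldl T.after [])) hq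
    (fun v => T.sum_occupancy_children_le v _) (v := T.root)
    (hroot ▸ (numAgents_pos h hS).ne')
  rw [hroot, parent_root, depth_root, zero_add, leastTravel, subtreeSum_root] at hserve
  rw [cost_eq q h, travel_eq_sum h]
  refine hserve.trans (add_le_add_right (Finset.sum_le_sum fun c _ => ?_) _)
  by_cases hc : c = T.root
  · rw [hc, parentWeight_root, zero_mul, zero_mul]
  · exact mul_le_mul_of_nonneg_left (Nat.cast_le.2 (leastCrossings_le h hS hc))
      (T.parentWeight_nonneg c)

end LowerBound

end WeightedTree

theorem mainTheorem1 :
    ∃ C : ℕ, ∀ (V : Type) [Fintype V] [DecidableEq V] (T : WeightedTree V) (q : ℝ),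
      2 ≤ Fintype.card V → 0 ≤ q →
        (∃ S : List (Move V), T.Expands [] (T.costExpl q).val S) ∧
        (∀ S : List (Move V), T.Expands [] (T.costExpl q).val S → T.IsCostOptimal q S) ∧
        (T.costExpl q).steps ≤ C * Fintype.card V := by
  refine ⟨49, fun V _ _ T q hcard hq => ?_⟩
  have : Nontrivial V := Fintype.one_lt_card_iff_nontrivial.1 hcard
  obtain ⟨hexecutable, hcorrect⟩ := WeightedTree.ensures_costExpl (T := T) hq
  refine ⟨hexecutable, fun S hS => ?_, T.steps_costExpl_le q⟩
  obtain ⟨hlegal, hexplores, hcost⟩ := hcorrect S hS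
  refine ⟨hlegal, hexplores, fun S' hlegal' hexplores' => ?_⟩
  rw [WeightedTree.cost_eq q hlegal, hcost]
  exact WeightedTree.serve_root_le_cost hq hlegal' hexplores'
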